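/- Let $\mathbb P\ll\mathbb Q$ be probability distributions on a measurable space $\mathcal X$, with likelihood ratio $g_0=d\mathbb P/d\mathbb Q$ (any nonnegative measurable version). Let $X_1,X_2,\dots$ be i.i.d. from $\mathbb P$ and $Y_1,Y_2,\dots$ i.i.d. from $\mathbb Q$, with empirical distributions $\mathbb P_n,\mathbb Q_n$ of the first $n$ observations. Let $\mathcal G$ be a class of measurable functions $g:\mathcal X\to[0,\infty)$ that contains some $g$ with $g=g_0$ $\mathbb Q$-a.e. For each $n\ge 1$ let, almost surely, $$\hat g_n\in\operatorname*{argmax}_{g\in\mathcal G}\Big\{\int\log g\,d\mathbb P_n-\int g\,d\mathbb Q_n\Big\},\qquad \hat D_K=\int\log\hat g_n\,d\mathbb P_n-\int\hat g_n\,d\mathbb Q_n+1$$ (with $\log 0=-\infty$), and let $h_{\mathbb Q}(g_0,g)=\big(\tfrac12\int(\sqrt{g_0}-\sqrt g)^2\,d\mathbb Q\big)^{1/2}$. For a class $\mathcal F$ of real functions on $\mathcal X$ let $\mathcal H^B_\delta(\mathcal F,L_2(\mathbb Q))$ be the logarithm of the smallest $N$ for which there are pairs of measurable functions $(f^L_j,f^U_j)$,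 $1\le j\le N$, with $\|f^U_j-f^L_j\|_{L_2(\mathbb Q)}\le\delta$, such that each $f\in\mathcal F$ satisfies $f^L_j\le f\le f^U_j$ pointwise for some $j$. Suppose that for $\bar{\mathcal G}=\{((g+g_0)/2)^{1/2}: g\in\mathcal G\}$ there are constants $0<\gamma<2$ and $A$ with $\mathcal H^B_\delta(\bar{\mathcal G},L_2(\mathbb Q))\le A\,\delta^{-\gamma}$ for all $\delta>0$. (a) If there is a constant $K_2$ with $g(x)\le K_2$ for all $g\in\mathcal G$ and $x\in\mathcal X$, then $h_{\mathbb Q}(g_0,\hat g_n)=O_P(n^{-1/(\gamma+2)})$. (b) If there are constants $0<K_1\le K_2<\infty$ with $K_1\le g(x)\le K_2$ for all $g\in\mathcal G$ and $x\in\mathcal X$, then the Kullback-Leibler divergence $D_K(\mathbb P,\mathbb Q)$ is finite and $|\hat D_K-D_K(\mathbb P,\mathbb Q)|=O_P(n^{-1/2})$. Here $Z_n=O_P(r_n)$ means that for every $\varepsilon>0$ there is an $M$ such that $P(|Z_n|>M r_n)\le\varepsilon$ for all $n\ge1$ (outer probability, if $Z_n$ is not measurable). -/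

import Mathlib

open MeasureTheory ProbabilityTheory InformationTheory
open scoped ENNReal

noncomputable section

namespace KLEstim

variable {E Ω : Type*}

/-- `F` is covered by `N` brackets `[l j, u j]` with `‖u j - l j‖_{L_r(Q)} ≤ δ`: every `f ∈ F`
lies pointwise between `l j` and `u j` for some `j`. -/
def HasBracketing [MeasurableSpace E] (r : ℝ≥0∞) (Q : Measure E) (δ : ℝ) (F : Set (E → ℝ))
    (N : ℕ) : Prop :=
  ∃ l u : Fin N → E → ℝ,
    (∀ j, Measurable (l j) ∧ Measurable (u j) ∧
      eLpNorm (fun x => u j x - l j x) r Q ≤ ENNReal.ofReal δ) ∧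
    ∀ f ∈ F, ∃ j, ∀ x, l j x ≤ f x ∧ f x ≤ u j x

/-- The bracketing number of `F` in `L_r(Q)`, which is `⊤` if there is no finite bracketing. -/
def bracketingNumber [MeasurableSpace E] (r : ℝ≥0∞) (Q : Measure E) (δ : ℝ)
    (F : Set (E → ℝ)) : ℕ∞ :=
  sInf {N : ℕ∞ | ∃ m : ℕ, N = (m : ℕ∞) ∧ HasBracketing r Q δ F m}

/-- The bracketing entropy, that is the logarithm of the bracketing number, as an extended real
(`log ⊤ = ⊤`). -/
def bracketingEntropy [MeasurableSpace E] (r : ℝ≥0∞) (Q : Measure E) (δ : ℝ)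
    (F : Set (E → ℝ)) : EReal :=
  ENNReal.log ((bracketingNumber r Q δ F : ℕ∞) : ℝ≥0∞)

/-- The class of the functions `((g + g₀) / 2) ^ (1/2)`, `g ∈ G`. -/
def sqrtMidClass (G : Set (E → ℝ)) (g₀ : E → ℝ) : Set (E → ℝ) :=
  (fun g : E → ℝ => fun x => Real.sqrt ((g x + g₀ x) / 2)) '' G

/-- The (generalized) Hellinger distance `h_Q(g₀, g)`. -/
def hellinger [MeasurableSpace E] (Q : Measure E) (g₀ g : E → ℝ) : ℝ :=
  Real.sqrt ((1 / 2) * ∫ x, (Real.sqrt (g₀ x) - Real.sqrt (g x)) ^ 2 ∂Q)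

/-- The empirical criterion `∫ log g dP_n - ∫ g dQ_n` for the samples `x 0, …, x (n-1)` and
`y 0, …, y (n-1)`, with the convention `log 0 = -∞`. -/
def empCriterion (n : ℕ) (x y : ℕ → E) (g : E → ℝ) : EReal :=
  (((n : ℝ)⁻¹ : ℝ) : EReal) * (∑ i ∈ Finset.range n, ENNReal.log (ENNReal.ofReal (g (x i))))
    - (((n : ℝ)⁻¹ * ∑ i ∈ Finset.range n, g (y i) : ℝ) : EReal)

/-- `g` maximizes the empirical criterion over the class `G`. -/
def IsArgmax (G : Set (E → ℝ)) (n : ℕ) (x y : ℕ → E) (g : E → ℝ) : Prop :=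
  g ∈ G ∧ ∀ g' ∈ G, empCriterion n x y g' ≤ empCriterion n x y g

/-- The estimate `∫ log g dP_n - ∫ g dQ_n + 1` of the Kullback-Leibler divergence that is
computed from `g`. The criterion is a finite number whenever `g` is positive on the sample. -/
def klEstimate (n : ℕ) (x y : ℕ → E) (g : E → ℝ) : ℝ :=
  (empCriterion n x y g).toReal + 1

/-- `Z n = O_μ(r n)`: the sequence `Z n / r n`, `n ≥ 1`, is bounded in probability. If `Z n` is
not measurable, then the probability is the outer probability. -/
def IsBigOInProb [MeasurableSpace Ω] (μ : Measure Ω) (Z : ℕ → Ω → ℝ) (r : ℕ → ℝ) : Prop :=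
  ∀ ε : ℝ, 0 < ε → ∃ M : ℝ, ∀ n : ℕ, 1 ≤ n →
    μ {ω | M * r n < |Z n ω|} ≤ ENNReal.ofReal ε

end KLEstim

end

/-! Write `m = (g + g₀) / 2` and `D(g) = ∫ (√m - √g₀)² dQ`. By concavity of the logarithm, half the
gap of the criterion between `g` and `g₀` is at most the `P`-sample mean of `log (m / g₀)` plus the
`Q`-sample mean of `g₀ - m`. The expectation of this sum is at most `-D(g)`, because `log z ≤ 2 (√z
- 1)` (`drift_le`). The gap is nonnegative at the maximizer, so `D(ĝ)` is bounded by the centred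
joint process at `ĝ` (`realCriterion_sub_le`, `RatioModel.ae_argmax`), and the Hellinger distance is
at most `4 √D` (`hellinger_le`). Midpoints are used because `m ≥ g₀ / 2`: the function `log (m /
g₀)` is then bounded below, and its second order exponential moments are controlled by `D` although
it need not be bounded above.

What remains is a modulus of continuity: over `D ≤ R²` the process has a majorant of expectation at
most a constant times `R ^ (1 - γ/2) / √n`, provided `R ^ (1 + γ/2) √n ≥ 1` and `R` is at most a
constant (`exists_majorant_ball`). It comes from chaining along brackets with adaptive truncation
(`IsSample.exists_majorant_chain`, `IsSample.exists_majorant_entropy`), fed by a Bernstein-type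
maximal inequality for finite families (`IsSample.exists_majorant`). Only upper deviations are ever
needed. Suprema over the class, which may fail to be measurable, are replaced throughout by
integrable majorants.

For (a), the modulus is summed over dyadic shells of `√D` (`RatioModel.measure_rate_le`). For (b),
no localization is needed: a ball of radius `2 √K` is the whole class, so the gap of the criterion
between `ĝ` and `g₀` lies between `0` and a term of order `n ^ (-1/2)`, and the criterion at `g₀`
differs from its mean by centred averages of bounded functions. -/

namespace KLEstim

/-! ### Exponential moments and a maximal inequality for finitely many functions -/

/-- The second order remainder of the exponential function. -/
noncomputable def expRem (x : ℝ) : ℝ := Real.exp x - 1 - x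

lemma expRem_nonneg (x : ℝ) : 0 ≤ expRem x := by
  have := Real.add_one_le_exp x
  unfold expRem
  linarith

lemma expRem_le_sq {x : ℝ} (hx : |x| ≤ 1) : expRem x ≤ x ^ 2 :=
  (le_abs_self _).trans (Real.abs_exp_sub_one_sub_id_le hx)

lemma hasDerivAt_expRem (x : ℝ) : HasDerivAt expRem (Real.exp x - 1) x := by
  exact ((Real.hasDerivAt_exp x).sub_const 1).sub (hasDerivAt_id' x)

lemma measurable_expRem : Measurable expRem := by
  unfold expRem
  fun_prop

lemma monotoneOn_expRem : MonotoneOn expRem (Set.Ici 0) := by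
  apply monotoneOn_of_deriv_nonneg (convex_Ici 0)
  · exact fun x _ => (hasDerivAt_expRem x).continuousAt.continuousWithinAt
  · exact fun x _ => (hasDerivAt_expRem x).differentiableAt.differentiableWithinAt
  · intro x hx
    rw [interior_Ici] at hx
    rw [(hasDerivAt_expRem x).deriv]
    have := Real.one_le_exp (le_of_lt hx)
    linarith

/-- In the power series of `expRem (a * t)` each `a ^ k` with `k ≥ 2` is at most `a ^ 2`. The formal
proof differentiates the difference of the two sides and uses convexity of `exp` between `0` and
`x`. -/
lemma expRem_mul_le {a t : ℝ} (ha : 0 ≤ a) (ha1 : a ≤ 1) (ht : 0 ≤ t) :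
    expRem (a * t) ≤ a ^ 2 * expRem t := by
  have hd : ∀ x, HasDerivAt (fun t => a ^ 2 * expRem t - expRem (a * t))
      (a ^ 2 * (Real.exp x - 1) - (Real.exp (a * x) - 1) * a) x := by
    intro x
    have h1 : HasDerivAt (fun t : ℝ => a * t) a x := by
      simpa using (hasDerivAt_id x).const_mul a
    exact ((hasDerivAt_expRem x).const_mul _).sub ((hasDerivAt_expRem (a * x)).comp x h1)
  have hmono : MonotoneOn (fun t => a ^ 2 * expRem t - expRem (a * t)) (Set.Ici 0) := by
    apply monotoneOn_of_deriv_nonneg (convex_Ici 0)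
    · exact fun x _ => (hd x).continuousAt.continuousWithinAt
    · exact fun x _ => (hd x).differentiableAt.differentiableWithinAt
    · intro x _
      rw [(hd x).deriv]
      have hc := convexOn_exp.2 (Set.mem_univ 0) (Set.mem_univ x) (sub_nonneg.2 ha1) ha
        (by ring)
      simp only [smul_eq_mul, mul_zero, zero_add, Real.exp_zero, mul_one] at hc
      nlinarith
  have := hmono (Set.mem_Ici.2 le_rfl) (Set.mem_Ici.2 ht) ht
  simp only [mul_zero, expRem, Real.exp_zero] at this ⊢
  linarith

/-- Applied with `y` a ratio of square roots of densities, so that the right side is of squared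
Hellinger type. For `y ≥ 1` no boundedness is needed, since `exp (2 log y) = y ^ 2` is itself
quadratic. For `y ≤ 1` the bound `y ^ 2 ≥ 1/2` keeps the argument in `[-1, 0]`, where `expRem` is at
most the square. -/
lemma expRem_mul_two_log_le {a y : ℝ} (ha : 0 ≤ a) (ha1 : a ≤ 1) (hy0 : 0 < y)
    (hy : 1 / 2 ≤ y ^ 2) : expRem (a * (2 * Real.log y)) ≤ 8 * a ^ 2 * (y - 1) ^ 2 := by
  rcases le_total 1 y with h | h
  · have hl := Real.log_nonneg h
    refine (expRem_mul_le ha ha1 (by positivity)).trans ?_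
    have h1 : Real.log y⁻¹ ≤ y⁻¹ - 1 := Real.log_le_sub_one_of_pos (by positivity)
    rw [Real.log_inv] at h1
    have h2 : expRem (2 * Real.log y) ≤ 8 * (y - 1) ^ 2 := by
      have h3 : Real.exp (2 * Real.log y) = y ^ 2 := by
        rw [mul_comm, Real.exp_mul, Real.exp_log hy0]
        norm_cast
      have h4 : y⁻¹ ≤ 1 := inv_le_one_of_one_le₀ h
      have h5 : y * y⁻¹ = 1 := mul_inv_cancel₀ hy0.ne'
      have h6 : y⁻¹ - 1 = -(y - 1) + (y - 1) ^ 2 * y⁻¹ := by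
        field_simp
        ring
      have h7 : (y - 1) ^ 2 * y⁻¹ ≤ (y - 1) ^ 2 := mul_le_of_le_one_right (sq_nonneg _) h4
      unfold expRem
      rw [h3]
      nlinarith [sq_nonneg (y - 1)]
    nlinarith [sq_nonneg a]
  · have hl : Real.log y ≤ 0 := Real.log_nonpos hy0.le h
    have h1 : Real.log y⁻¹ ≤ y⁻¹ - 1 := Real.log_le_sub_one_of_pos (by positivity)
    rw [Real.log_inv] at h1
    have hlow : -1 ≤ 2 * Real.log y := by
      have h2 : Real.log (1 / 2) ≤ Real.log (y ^ 2) := Real.log_le_log (by norm_num) hy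
      rw [Real.log_pow] at h2
      have := Real.log_two_lt_d9
      rw [one_div, Real.log_inv] at h2
      push_cast at h2
      linarith
    have hx : |a * (2 * Real.log y)| ≤ 1 := by
      rw [abs_le]
      constructor <;> nlinarith
    refine (expRem_le_sq hx).trans ?_
    have h6 : (-Real.log y) ^ 2 ≤ (y⁻¹ - 1) ^ 2 := pow_le_pow_left₀ (by linarith) h1 2
    have h7 : (y⁻¹ - 1) ^ 2 ≤ 2 * (y - 1) ^ 2 := by
      have : (y⁻¹ - 1) ^ 2 = (y - 1) ^ 2 / y ^ 2 := by
        field_simp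
        ring
      rw [this, div_le_iff₀ (by positivity)]
      nlinarith [sq_nonneg (y - 1)]
    have : (Real.log y) ^ 2 ≤ 2 * (y - 1) ^ 2 := by linarith [neg_sq (Real.log y)]
    nlinarith [sq_nonneg a, mul_le_mul_of_nonneg_left this (sq_nonneg a)]

variable {E Ω : Type*} [MeasurableSpace E] [MeasurableSpace Ω]

/-- A Bernstein condition for the function `h` under `ν` at scale `K` with variance proxy `v`. -/
structure BernsteinAt (ν : Measure E) (h : E → ℝ) (K v : ℝ) : Prop where
  meas : Measurable h
  integrable : Integrable h ν
  integrable_exp : Integrable (fun x => Real.exp (h x / K)) ν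
  integral_le : ∫ x, expRem (h x / K) ∂ν ≤ v / K ^ 2

lemma BernsteinAt.of_expRem_le {ν : Measure E} [IsFiniteMeasure ν] {h φ : E → ℝ} {K v : ℝ}
    (hm : Measurable h) (hi : Integrable h ν) (hφ : Integrable φ ν)
    (hle : ∀ᵐ x ∂ν, expRem (h x / K) ≤ φ x / K ^ 2) (hv : ∫ x, φ x ∂ν ≤ v) :
    BernsteinAt ν h K v := by
  have hr : Integrable (fun x => expRem (h x / K)) ν := by
    refine (hφ.div_const (K ^ 2)).mono'
      (measurable_expRem.comp (hm.div_const K)).aestronglyMeasurable ?_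
    filter_upwards [hle] with x hx
    rwa [Real.norm_of_nonneg (expRem_nonneg _)]
  refine ⟨hm, hi, ?_, ?_⟩
  · have := (hr.add (integrable_const (1 : ℝ))).add (hi.div_const K)
    refine this.congr (Filter.Eventually.of_forall fun x => ?_)
    simp only [expRem, Pi.add_apply]
    ring
  · calc ∫ x, expRem (h x / K) ∂ν ≤ ∫ x, φ x / K ^ 2 ∂ν :=
          integral_mono_ae hr (hφ.div_const _) hle
      _ = (∫ x, φ x ∂ν) / K ^ 2 := integral_div _ _
      _ ≤ v / K ^ 2 := by gcongr

lemma BernsteinAt.of_abs_le {ν : Measure E} [IsFiniteMeasure ν] {h : E → ℝ} {K v : ℝ}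
    (hK : 0 < K) (hm : Measurable h) (hb : ∀ x, |h x| ≤ K) (hv : ∫ x, h x ^ 2 ∂ν ≤ v) :
    BernsteinAt ν h K v := by
  have hi : Integrable h ν :=
    Integrable.of_bound hm.aestronglyMeasurable K (Filter.Eventually.of_forall hb)
  have hi2 : Integrable (fun x => h x ^ 2) ν := by
    refine Integrable.of_bound (hm.pow_const 2).aestronglyMeasurable (K ^ 2)
      (Filter.Eventually.of_forall fun x => ?_)
    rw [norm_pow]
    exact pow_le_pow_left₀ (norm_nonneg _) (hb x) 2
  refine .of_expRem_le hm hi hi2 (Filter.Eventually.of_forall fun x => ?_) hv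
  rw [← div_pow]
  apply expRem_le_sq
  rw [abs_div, abs_of_pos hK]
  exact div_le_one_of_le₀ (hb x) hK.le

/-- The deviation of the empirical mean of `f` over the first `n` observations from its mean
under `ν`. -/
noncomputable def empDev (ν : Measure E) (Z : ℕ → Ω → E) (n : ℕ) (f : E → ℝ) (ω : Ω) : ℝ :=
  (n : ℝ)⁻¹ * ∑ i ∈ Finset.range n, f (Z i ω) - ∫ x, f x ∂ν

/-- `Z` is an i.i.d. sample from `ν`. -/
structure IsSample (μ : Measure Ω) (ν : Measure E) (Z : ℕ → Ω → E) : Prop where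
  meas : ∀ i, Measurable (Z i)
  law : ∀ i, μ.map (Z i) = ν
  indep : iIndepFun Z μ

section Sample

variable {μ : Measure Ω} [IsProbabilityMeasure μ] {ν : Measure E} [IsProbabilityMeasure ν]
  {Z : ℕ → Ω → E}

/-- Each observation contributes `∫ exp (h / K) = 1 + ∫ h / K + ∫ expRem (h / K)`, which is at most
the exponential of `∫ h / K + v / K ^ 2`; centring cancels the first order term. -/
lemma IsSample.exp_empDev (hZ : IsSample μ ν Z) {n : ℕ} (hn : 1 ≤ n) {h : E → ℝ} {K v : ℝ}
    (hK : 0 < K) (hh : BernsteinAt ν h K v) :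
    Integrable (fun ω => Real.exp (n / K * empDev ν Z n h ω)) μ ∧
      ∫ ω, Real.exp (n / K * empDev ν Z n h ω) ∂μ ≤ Real.exp (n * v / K ^ 2) := by
  have hn0 : (0 : ℝ) < n := by exact_mod_cast hn
  set Y : ℕ → Ω → ℝ := fun i ω => h (Z i ω) / K with hY
  have hhm : Measurable (fun x => h x / K) := hh.meas.div_const K
  have hYm : ∀ i, Measurable (Y i) := fun i => hhm.comp (hZ.meas i)
  have hYi : iIndepFun Y μ := hZ.indep.comp (fun _ x => h x / K) (fun _ => hhm)
  have hint : ∀ i, Integrable (fun ω => Real.exp (1 * Y i ω)) μ := by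
    intro i
    have h1 := hh.integrable_exp
    rw [← hZ.law i] at h1
    simpa [Function.comp_def] using h1.comp_measurable (hZ.meas i)
  have hmgf : ∀ i, mgf (Y i) μ 1 ≤ Real.exp ((∫ x, h x ∂ν) / K + v / K ^ 2) := by
    intro i
    have h1 : mgf (Y i) μ 1 = ∫ x, Real.exp (h x / K) ∂ν := by
      rw [mgf, ← hZ.law i, integral_map (hZ.meas i).aemeasurable]
      · simp [hY]
      · exact (Real.measurable_exp.comp hhm).aestronglyMeasurable
    have h2 : ∫ x, Real.exp (h x / K) ∂ν
        = ∫ x, expRem (h x / K) ∂ν + 1 + (∫ x, h x ∂ν) / K := by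
      have hi := hh.integrable.div_const K
      have : Integrable (fun x => expRem (h x / K)) ν :=
        (hh.integrable_exp.sub (integrable_const (1 : ℝ))).sub hi
      rw [← integral_div]
      have h3 : ∫ x, Real.exp (h x / K) ∂ν = ∫ x, (expRem (h x / K) + 1 + h x / K) ∂ν := by
        congr 1 with x
        unfold expRem
        ring
      rw [h3, integral_add (f := fun x => expRem (h x / K) + 1)
        (this.add (integrable_const _)) hi,
        integral_add this (integrable_const _)]
      simp
    have h4 := Real.add_one_le_exp ((∫ x, h x ∂ν) / K + v / K ^ 2)
    have := hh.integral_le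
    linarith
  have hrew : ∀ ω, Real.exp (n / K * empDev ν Z n h ω)
      = Real.exp (-(n * (∫ x, h x ∂ν) / K))
        * Real.exp (1 * (∑ i ∈ Finset.range n, Y i) ω) := by
    intro ω
    rw [← Real.exp_add]
    congr 1
    simp only [empDev, hY, Finset.sum_apply, ← Finset.sum_div]
    field_simp
    ring
  have hmg := hYi.mgf_sum (t := 1) hYm (Finset.range n)
  have hi := hYi.integrable_exp_mul_sum (t := 1) hYm (s := Finset.range n) (fun i _ => hint i)
  simp_rw [hrew]
  refine ⟨hi.const_mul _, ?_⟩
  rw [integral_const_mul]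
  change _ * mgf (∑ i ∈ Finset.range n, Y i) μ 1 ≤ _
  rw [hmg]
  calc Real.exp (-(n * (∫ x, h x ∂ν) / K)) * ∏ i ∈ Finset.range n, mgf (Y i) μ 1
      ≤ Real.exp (-(n * (∫ x, h x ∂ν) / K))
        * ∏ i ∈ Finset.range n, Real.exp ((∫ x, h x ∂ν) / K + v / K ^ 2) := by
        gcongr with i
        · exact fun i _ => mgf_nonneg
        · exact hmgf i
    _ = Real.exp (n * v / K ^ 2) := by
        rw [Finset.prod_const, Finset.card_range, ← Real.exp_nat_mul, ← Real.exp_add]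
        congr 1
        ring

/-- The expected maximum of finitely many empirical deviations, in the form of an integrable
majorant. -/
lemma IsSample.exists_majorant (hZ : IsSample μ ν Z) {n : ℕ} (hn : 1 ≤ n) {ι : Type*} [Fintype ι]
    {h : ι → E → ℝ} {K v H : ℝ} (hK : 0 < K) (hv : 0 ≤ v) (hH : 0 ≤ H)
    (hcard : (Fintype.card ι : ℝ) ≤ Real.exp H) (hh : ∀ i, BernsteinAt ν (h i) K v) :
    ∃ W : Ω → ℝ, Integrable W μ ∧ (∀ ω, 0 ≤ W ω) ∧
      ∫ ω, W ω ∂μ ≤ K / n * (1 + H) + v / K ∧ ∀ i ω, empDev ν Z n (h i) ω ≤ W ω := by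
  have hn0 : (0 : ℝ) < n := by exact_mod_cast hn
  set L : ℝ := H + n * v / K ^ 2 with hL
  have hL0 : 0 ≤ L := by positivity
  set S : Ω → ℝ := fun ω => ∑ i, Real.exp (n / K * empDev ν Z n (h i) ω) with hS
  have hSi : Integrable S μ := integrable_finsetSum _ fun i _ => (hZ.exp_empDev hn hK (hh i)).1
  have hSle : ∫ ω, S ω ∂μ ≤ Real.exp L := by
    rw [hS, integral_finsetSum _ fun i _ => (hZ.exp_empDev hn hK (hh i)).1]
    calc ∑ i, ∫ ω, Real.exp (n / K * empDev ν Z n (h i) ω) ∂μ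
        ≤ ∑ _i : ι, Real.exp (n * v / K ^ 2) :=
          Finset.sum_le_sum fun i _ => (hZ.exp_empDev hn hK (hh i)).2
      _ = Fintype.card ι * Real.exp (n * v / K ^ 2) := by simp
      _ ≤ Real.exp H * Real.exp (n * v / K ^ 2) := by gcongr
      _ = Real.exp L := by rw [← Real.exp_add]
  have hS0 : ∀ ω, 0 ≤ S ω := fun ω => Finset.sum_nonneg fun i _ => (Real.exp_pos _).le
  -- The tangent `z - L + 1 ≤ exp (z - L)` replaces the logarithm of the sum of exponentials; `L` is
  -- chosen so that `S / exp L` has mean at most `1`.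
  refine ⟨fun ω => K / n * (S ω / Real.exp L + L), ?_, ?_, ?_, ?_⟩
  · exact ((hSi.div_const _).add (integrable_const _)).const_mul _
  · intro ω
    have := hS0 ω
    positivity
  · rw [integral_const_mul, integral_add (hSi.div_const _) (integrable_const _), integral_div]
    simp only [integral_const, probReal_univ, one_smul]
    have h1 : (∫ ω, S ω ∂μ) / Real.exp L ≤ 1 := div_le_one_of_le₀ hSle (Real.exp_pos _).le
    calc K / n * ((∫ ω, S ω ∂μ) / Real.exp L + L) ≤ K / n * (1 + L) := by gcongr
      _ = K / n * (1 + H) + v / K := by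
        rw [hL]
        field_simp
        ring
  · intro i ω
    set d := empDev ν Z n (h i) ω with hd
    have h1 : Real.exp (n / K * d) ≤ S ω :=
      Finset.single_le_sum (f := fun i => Real.exp (n / K * empDev ν Z n (h i) ω))
        (fun i _ => (Real.exp_pos _).le) (Finset.mem_univ i)
    have h2 : n / K * d - L + 1 ≤ S ω / Real.exp L := by
      calc n / K * d - L + 1 ≤ Real.exp (n / K * d - L) := Real.add_one_le_exp _
        _ = Real.exp (n / K * d) / Real.exp L := Real.exp_sub _ _
        _ ≤ _ := by gcongr
    calc d = K / n * (n / K * d) := by field_simp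
      _ ≤ K / n * (S ω / Real.exp L + L) := by
        gcongr
        linarith

end Sample

/-! ### Chaining with adaptive truncation along nested brackets -/

section Paths

variable {E : Type*} {ι : ℕ → Type}

/-- The running maximum of the lower brackets along the path `t`. -/
noncomputable def lowerEnv (l : ∀ k, ι k → E → ℝ) (t : ∀ k, ι k) : ℕ → E → ℝ
  | 0 => l 0 (t 0)
  | k + 1 => fun x => max (lowerEnv l t k x) (l (k + 1) (t (k + 1)) x)

/-- The running minimum of the upper brackets along the path `t`. -/
noncomputable def upperEnv (u : ∀ k, ι k → E → ℝ) (t : ∀ k, ι k) : ℕ → E → ℝ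
  | 0 => u 0 (t 0)
  | k + 1 => fun x => min (upperEnv u t k x) (u (k + 1) (t (k + 1)) x)

/-- The width of the intersected bracket along the path `t`. -/
noncomputable def width (l u : ∀ k, ι k → E → ℝ) (t : ∀ k, ι k) (k : ℕ) (x : E) : ℝ :=
  upperEnv u t k x - lowerEnv l t k x

/-- The points at which the widths of the first `k` brackets stay below the truncation levels. -/
def truncSet (l u : ∀ k, ι k → E → ℝ) (κ : ℕ → ℝ) (t : ∀ k, ι k) : ℕ → Set E
  | 0 => Set.univ
  | k + 1 => truncSet l u κ t k ∩ {x | width l u t k x ≤ κ (k + 1)}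

open Classical in
/-- The link of the chain: the increment of the lower bracket while the truncation levels are not
exceeded, and the width of the bracket where they are exceeded for the first time. -/
noncomputable def chainLink (l u : ∀ k, ι k → E → ℝ) (κ : ℕ → ℝ) (t : ∀ k, ι k) (k : ℕ) (x : E) :
    ℝ :=
  if x ∈ truncSet l u κ t (k + 1) then lowerEnv l t (k + 1) x - lowerEnv l t k x
  else if x ∈ truncSet l u κ t k then width l u t k x else 0

/-- The path `t` follows brackets of `f`. -/
def IsPathOf (l u : ∀ k, ι k → E → ℝ) (f : E → ℝ) (t : ∀ k, ι k) : Prop :=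
  ∀ k x, l k (t k) x ≤ f x ∧ f x ≤ u k (t k) x

variable {l u : ∀ k, ι k → E → ℝ} {κ : ℕ → ℝ} {t t' : ∀ k, ι k} {f : E → ℝ}

lemma lowerEnv_congr {k : ℕ} (h : ∀ j < k + 1, t j = t' j) : lowerEnv l t k = lowerEnv l t' k := by
  induction k with
  | zero => simp [lowerEnv, h 0 (by simp)]
  | succ k ih =>
    simp only [lowerEnv, ih fun j hj => h j (by omega), h (k + 1) (by omega)]

lemma upperEnv_congr {k : ℕ} (h : ∀ j < k + 1, t j = t' j) : upperEnv u t k = upperEnv u t' k := by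
  induction k with
  | zero => simp [upperEnv, h 0 (by simp)]
  | succ k ih =>
    simp only [upperEnv, ih fun j hj => h j (by omega), h (k + 1) (by omega)]

lemma width_congr {k : ℕ} (h : ∀ j < k + 1, t j = t' j) : width l u t k = width l u t' k := by
  ext x
  simp only [width, upperEnv_congr h, lowerEnv_congr h]

lemma truncSet_congr {k : ℕ} (h : ∀ j < k, t j = t' j) :
    truncSet l u κ t k = truncSet l u κ t' k := by
  induction k with
  | zero => rfl
  | succ k ih =>
    simp only [truncSet, ih fun j hj => h j (by omega), width_congr h]

/-- Link `k` involves the lower bracket of level `k + 1`, hence the coordinates `0, …, k + 1`. Its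
entropy cost is that of `k + 2` levels. -/
lemma chainLink_congr {k : ℕ} (h : ∀ j < k + 2, t j = t' j) :
    chainLink l u κ t k = chainLink l u κ t' k := by
  have h1 : ∀ j < k + 1, t j = t' j := fun j hj => h j (by omega)
  ext x
  unfold chainLink
  rw [lowerEnv_congr h, lowerEnv_congr h1, width_congr h1, truncSet_congr h1,
    truncSet_congr fun j hj => h1 j (by omega)]

lemma lowerEnv_le_succ (k : ℕ) (x : E) : lowerEnv l t k x ≤ lowerEnv l t (k + 1) x :=
  le_max_left _ _

lemma lowerEnv_zero_le (k : ℕ) (x : E) : l 0 (t 0) x ≤ lowerEnv l t k x := by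
  induction k with
  | zero => rfl
  | succ k ih => exact ih.trans (lowerEnv_le_succ k x)

lemma upperEnv_succ_le (k : ℕ) (x : E) : upperEnv u t (k + 1) x ≤ upperEnv u t k x :=
  min_le_left _ _

lemma upperEnv_le_zero (k : ℕ) (x : E) : upperEnv u t k x ≤ u 0 (t 0) x := by
  induction k with
  | zero => rfl
  | succ k ih => exact (upperEnv_succ_le k x).trans ih

lemma le_lowerEnv (k : ℕ) (x : E) : l k (t k) x ≤ lowerEnv l t k x := by
  cases k with
  | zero => rfl
  | succ k => exact le_max_right _ _

lemma upperEnv_le (k : ℕ) (x : E) : upperEnv u t k x ≤ u k (t k) x := by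
  cases k with
  | zero => rfl
  | succ k => exact min_le_right _ _

lemma width_succ_le (k : ℕ) (x : E) : width l u t (k + 1) x ≤ width l u t k x :=
  sub_le_sub (upperEnv_succ_le k x) (lowerEnv_le_succ k x)

lemma width_le_zero (k : ℕ) (x : E) : width l u t k x ≤ u 0 (t 0) x - l 0 (t 0) x :=
  sub_le_sub (upperEnv_le_zero k x) (lowerEnv_zero_le k x)

lemma width_le (k : ℕ) (x : E) : width l u t k x ≤ u k (t k) x - l k (t k) x :=
  sub_le_sub (upperEnv_le k x) (le_lowerEnv k x)

lemma IsPathOf.lowerEnv_le (h : IsPathOf l u f t) (k : ℕ) (x : E) : lowerEnv l t k x ≤ f x := by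
  induction k with
  | zero => exact (h 0 x).1
  | succ k ih => exact max_le ih (h (k + 1) x).1

lemma IsPathOf.le_upperEnv (h : IsPathOf l u f t) (k : ℕ) (x : E) : f x ≤ upperEnv u t k x := by
  induction k with
  | zero => exact (h 0 x).2
  | succ k ih => exact le_min ih (h (k + 1) x).2

lemma IsPathOf.sub_lowerEnv_le_width (h : IsPathOf l u f t) (k : ℕ) (x : E) :
    f x - lowerEnv l t k x ≤ width l u t k x :=
  sub_le_sub_right (h.le_upperEnv k x) _

lemma IsPathOf.width_nonneg (h : IsPathOf l u f t) (k : ℕ) (x : E) : 0 ≤ width l u t k x :=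
  sub_nonneg.2 ((h.lowerEnv_le k x).trans (h.le_upperEnv k x))

lemma truncSet_succ_subset (k : ℕ) : truncSet l u κ t (k + 1) ⊆ truncSet l u κ t k :=
  Set.inter_subset_left

lemma IsPathOf.chainLink_nonneg (h : IsPathOf l u f t) (k : ℕ) (x : E) :
    0 ≤ chainLink l u κ t k x := by
  unfold chainLink
  split_ifs
  · exact sub_nonneg.2 (lowerEnv_le_succ k x)
  · exact h.width_nonneg k x
  · exact le_rfl

lemma IsPathOf.chainLink_le_width (h : IsPathOf l u f t) (k : ℕ) (x : E) :
    chainLink l u κ t k x ≤ width l u t k x := by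
  unfold chainLink
  split_ifs
  · exact sub_le_sub_right ((h.lowerEnv_le _ x).trans (h.le_upperEnv k x)) _
  · exact le_rfl
  · exact h.width_nonneg k x

/-- The link vanishes off `truncSet (k + 1)`, and there the width of level `k`, which dominates the
width of level `k + 1`, is already below `κ (k + 1)`. Link `0` has no such bound, so the coarsest
brackets need their own Bernstein condition. -/
lemma IsPathOf.chainLink_succ_le (h : IsPathOf l u f t) (hκ : ∀ k, 0 ≤ κ k) (k : ℕ) (x : E) :
    chainLink l u κ t (k + 1) x ≤ κ (k + 1) := by
  by_cases hx : x ∈ truncSet l u κ t (k + 1)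
  · exact (h.chainLink_le_width _ x).trans ((width_succ_le k x).trans hx.2)
  · have hx' : x ∉ truncSet l u κ t (k + 1 + 1) := fun h' => hx (truncSet_succ_subset _ h')
    rw [chainLink, if_neg hx', if_neg hx]
    exact hκ _

open Classical in
/-- The part of `f` that is left after `k` links of the chain. -/
noncomputable def chainRest (l u : ∀ k, ι k → E → ℝ) (κ : ℕ → ℝ) (t : ∀ k, ι k) (f : E → ℝ)
    (k : ℕ) (x : E) : ℝ :=
  if x ∈ truncSet l u κ t k then f x - lowerEnv l t k x else 0

lemma chainRest_zero (x : E) : chainRest l u κ t f 0 x = f x - l 0 (t 0) x := by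
  simp [chainRest, truncSet, lowerEnv]

lemma IsPathOf.chainRest_nonneg (h : IsPathOf l u f t) (k : ℕ) (x : E) :
    0 ≤ chainRest l u κ t f k x := by
  unfold chainRest
  split_ifs
  · exact sub_nonneg.2 (h.lowerEnv_le k x)
  · exact le_rfl

lemma IsPathOf.chainRest_le_zero (h : IsPathOf l u f t) (k : ℕ) (x : E) :
    chainRest l u κ t f k x ≤ u 0 (t 0) x - l 0 (t 0) x := by
  unfold chainRest
  split_ifs
  · exact (h.sub_lowerEnv_le_width k x).trans (width_le_zero k x)
  · exact (h.width_nonneg 0 x).trans (width_le_zero 0 x)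

lemma IsPathOf.chainRest_succ_le (h : IsPathOf l u f t) (hκ : ∀ k, 0 ≤ κ k) (k : ℕ) (x : E) :
    chainRest l u κ t f (k + 1) x ≤ κ (k + 1) := by
  unfold chainRest
  split_ifs with hx
  · exact (h.sub_lowerEnv_le_width _ x).trans ((width_succ_le k x).trans hx.2)
  · exact hκ _

/-- Equality holds while the truncation level is respected. At the first exceedance the chain stops
and the remainder is dominated by the current width, which the link contains. -/
lemma IsPathOf.chainRest_le (h : IsPathOf l u f t) (k : ℕ) (x : E) :
    chainRest l u κ t f k x ≤ chainLink l u κ t k x + chainRest l u κ t f (k + 1) x := by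
  unfold chainRest chainLink
  have hsub := @truncSet_succ_subset E ι l u κ t k
  by_cases hx : x ∈ truncSet l u κ t (k + 1)
  · simp [hx, hsub hx]
  · by_cases hx' : x ∈ truncSet l u κ t k
    · simpa [hx, hx'] using h.sub_lowerEnv_le_width k x
    · simp [hx, hx']

/-- The recursion loses something only where the width first exceeds `κ (k + 1)`, and there `width ≤
width ^ 2 / κ (k + 1)`. Truncation therefore costs a second moment divided by the level. -/
lemma IsPathOf.chain_excess_le (h : IsPathOf l u f t) (hκ : ∀ k, 0 < κ k) (k : ℕ) (x : E) :
    chainLink l u κ t k x + chainRest l u κ t f (k + 1) x - chainRest l u κ t f k x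
      ≤ width l u t k x ^ 2 / κ (k + 1) := by
  have h0 : 0 ≤ width l u t k x ^ 2 / κ (k + 1) := div_nonneg (sq_nonneg _) (hκ _).le
  unfold chainRest chainLink
  by_cases hx : x ∈ truncSet l u κ t (k + 1)
  · simpa [hx, truncSet_succ_subset _ hx] using h0
  · by_cases hx' : x ∈ truncSet l u κ t k
    · have hw : κ (k + 1) < width l u t k x := by
        by_contra hcon
        exact hx ⟨hx', not_lt.1 hcon⟩
      have hl := h.lowerEnv_le k x
      have : width l u t k x ≤ width l u t k x ^ 2 / κ (k + 1) := by
        rw [le_div_iff₀ (hκ _), sq]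
        exact mul_le_mul_of_nonneg_left hw.le (h.width_nonneg k x)
      simp only [hx, hx', if_true, if_false]
      linarith
    · simpa [hx, hx'] using h0

variable [MeasurableSpace E]

lemma measurable_lowerEnv (hl : ∀ k i, Measurable (l k i)) (k : ℕ) :
    Measurable (lowerEnv l t k) := by
  induction k with
  | zero => exact hl 0 _
  | succ k ih => exact ih.max (hl _ _)

lemma measurable_upperEnv (hu : ∀ k i, Measurable (u k i)) (k : ℕ) :
    Measurable (upperEnv u t k) := by
  induction k with
  | zero => exact hu 0 _
  | succ k ih => exact ih.min (hu _ _)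

lemma measurable_width (hl : ∀ k i, Measurable (l k i)) (hu : ∀ k i, Measurable (u k i)) (k : ℕ) :
    Measurable (width l u t k) :=
  (measurable_upperEnv hu k).sub (measurable_lowerEnv hl k)

lemma measurableSet_truncSet (hl : ∀ k i, Measurable (l k i)) (hu : ∀ k i, Measurable (u k i))
    (k : ℕ) : MeasurableSet (truncSet l u κ t k) := by
  induction k with
  | zero => exact .univ
  | succ k ih => exact ih.inter (measurableSet_le (measurable_width hl hu k) measurable_const)

lemma measurable_chainLink (hl : ∀ k i, Measurable (l k i)) (hu : ∀ k i, Measurable (u k i))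
    (k : ℕ) : Measurable (chainLink l u κ t k) :=
  Measurable.ite (measurableSet_truncSet hl hu _)
    ((measurable_lowerEnv hl _).sub (measurable_lowerEnv hl _))
    (Measurable.ite (measurableSet_truncSet hl hu _) (measurable_width hl hu k) measurable_const)

lemma measurable_chainRest (hl : ∀ k i, Measurable (l k i)) (hu : ∀ k i, Measurable (u k i))
    (hf : Measurable f) (k : ℕ) : Measurable (chainRest l u κ t f k) :=
  Measurable.ite (measurableSet_truncSet hl hu _) (hf.sub (measurable_lowerEnv hl _))
    measurable_const

end Paths

section EmpDev

variable {E Ω : Type*} [MeasurableSpace E]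

lemma empDev_add (ν : Measure E) (Z : ℕ → Ω → E) (n : ℕ) {f g : E → ℝ} (hf : Integrable f ν)
    (hg : Integrable g ν) (ω : Ω) :
    empDev ν Z n (fun x => f x + g x) ω = empDev ν Z n f ω + empDev ν Z n g ω := by
  simp only [empDev, Finset.sum_add_distrib, integral_add hf hg]
  ring

/-- This one-sided comparison lets a function be replaced by a pointwise larger one at the price of
the difference of the means. -/
lemma empDev_le_add (ν : Measure E) (Z : ℕ → Ω → E) (n : ℕ) {f g : E → ℝ} (hf : Integrable f ν)
    (hg : Integrable g ν) (hfg : ∀ x, f x ≤ g x) (ω : Ω) :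
    empDev ν Z n f ω ≤ empDev ν Z n g ω + ∫ x, (g x - f x) ∂ν := by
  rw [integral_sub hg hf]
  have : (n : ℝ)⁻¹ * ∑ i ∈ Finset.range n, f (Z i ω)
      ≤ (n : ℝ)⁻¹ * ∑ i ∈ Finset.range n, g (Z i ω) := by
    gcongr with i
    exact hfg _
  simp only [empDev]
  linarith

lemma empDev_div (ν : Measure E) (Z : ℕ → Ω → E) (n : ℕ) (f : E → ℝ) (c : ℝ) (ω : Ω) :
    empDev ν Z n (fun x => f x / c) ω = empDev ν Z n f ω / c := by
  simp only [empDev, ← Finset.sum_div, integral_div]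
  ring

end EmpDev

section Chaining

variable {E Ω : Type*} [MeasurableSpace E] [MeasurableSpace Ω]
  {μ : Measure Ω} [IsProbabilityMeasure μ] {ν : Measure E} [IsProbabilityMeasure ν]
  {Z : ℕ → Ω → E} {ι : ℕ → Type} [∀ k, Fintype (ι k)]

/-- The finite maximal inequality for functions which are indexed by paths but depend only on
the first `m` coordinates of the path. -/
lemma IsSample.exists_majorant_paths (hZ : IsSample μ ν Z) {n : ℕ} (hn : 1 ≤ n)
    (T : Set (∀ k, ι k)) (m : ℕ) {h : (∀ k, ι k) → E → ℝ} {K v H : ℝ} (hK : 0 < K)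
    (hv : 0 ≤ v) (hH : 0 ≤ H)
    (hcard : ∏ j ∈ Finset.range m, (Fintype.card (ι j) : ℝ) ≤ Real.exp H)
    (hcongr : ∀ t t' : ∀ k, ι k, (∀ j < m, t j = t' j) → h t = h t')
    (hh : ∀ t ∈ T, BernsteinAt ν (h t) K v) :
    ∃ W : Ω → ℝ, Integrable W μ ∧ (∀ ω, 0 ≤ W ω) ∧
      ∫ ω, W ω ∂μ ≤ K / n * (1 + H) + v / K ∧ ∀ t ∈ T, ∀ ω, empDev ν Z n (h t) ω ≤ W ω := by
  classical
  -- Each finite prefix gets a representative path in `T`; prefixes that no path of `T` realizes get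
  -- the zero function.
  let F : (∀ j : Fin m, ι j) → E → ℝ := fun s =>
    if hs : ∃ t ∈ T, (fun j : Fin m => t j) = s then h hs.choose else 0
  have hF : ∀ s, BernsteinAt ν (F s) K v := by
    intro s
    by_cases hs : ∃ t ∈ T, (fun j : Fin m => t j) = s
    · simp only [F, dif_pos hs]
      exact hh _ hs.choose_spec.1
    · simp only [F, dif_neg hs]
      exact .of_abs_le hK measurable_const (by simp [hK.le]) (by simpa using hv)
  obtain ⟨W, hWi, hW0, hWle, hW⟩ := hZ.exists_majorant hn (h := F) hK hv hH
    (by simpa [Fintype.card_pi, Finset.prod_range] using hcard) hF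
  refine ⟨W, hWi, hW0, hWle, fun t ht ω => ?_⟩
  have hs : ∃ t' ∈ T, (fun j : Fin m => t' j) = fun j : Fin m => t j := ⟨t, ht, rfl⟩
  have h1 := hW (fun j => t j) ω
  simp only [F, dif_pos hs] at h1
  rwa [hcongr _ t fun j hj => congrFun hs.choose_spec.2 ⟨j, hj⟩] at h1

/-- **Chaining with adaptive truncation.** If a class has brackets of widths `v k` at the levels
`k = 0, 1, …`, then its empirical deviations have an integrable majorant. -/
lemma IsSample.exists_majorant_chain (hZ : IsSample μ ν Z) {n : ℕ} (hn : 1 ≤ n)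
    {F : Set (E → ℝ)} (hF : ∀ f ∈ F, Measurable f) {l u : ∀ k, ι k → E → ℝ} {κ v H : ℕ → ℝ}
    (hκ : ∀ k, 0 < κ k) (hH : ∀ k, 0 ≤ H k)
    (hcard : ∀ k, ∏ j ∈ Finset.range (k + 1), (Fintype.card (ι j) : ℝ) ≤ Real.exp (H k))
    (hl : ∀ k i, Measurable (l k i)) (hu : ∀ k i, Measurable (u k i))
    (hint : ∀ k i, Integrable (fun x => (u k i x - l k i x) ^ 2) ν)
    (hv : ∀ k i, ∫ x, (u k i x - l k i x) ^ 2 ∂ν ≤ v k)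
    (hv0 : ∀ k, 0 ≤ v k)
    (hl0 : ∀ i, BernsteinAt ν (l 0 i) (κ 0) (v 0))
    (hw0 : ∀ i, BernsteinAt ν (fun x => u 0 i x - l 0 i x) (κ 0) (v 0))
    (hcov : ∀ f ∈ F, ∀ k, ∃ i, ∀ x, l k i x ≤ f x ∧ f x ≤ u k i x) (S : ℕ) :
    ∃ W : Ω → ℝ, Integrable W μ ∧ (∀ ω, 0 ≤ W ω) ∧
      ∫ ω, W ω ∂μ ≤ (κ 0 / n * (1 + H 0) + v 0 / κ 0)
        + ∑ k ∈ Finset.range (S + 1),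
          (κ k / n * (1 + H (k + 1)) + v k / κ k + v k / κ (k + 1)) + κ (S + 1) ∧
      ∀ f ∈ F, ∀ ω, empDev ν Z n f ω ≤ W ω := by
  set T : Set (∀ k, ι k) := {t | ∃ f ∈ F, IsPathOf l u f t} with hT
  obtain ⟨W₀, hW₀i, hW₀0, hW₀le, hW₀⟩ := hZ.exists_majorant_paths hn T 1
    (h := fun t => l 0 (t 0)) (hκ 0) (hv0 0) (hH 0) (hcard 0)
    (fun t t' h => by simp [h 0 (by simp)]) (fun t _ => hl0 _)
  have hsqint : ∀ t ∈ T, ∀ k, Integrable (fun x => width l u t k x ^ 2) ν ∧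
      ∫ x, width l u t k x ^ 2 ∂ν ≤ v k := by
    rintro t ⟨f, hf, hp⟩ k
    have hle : ∀ x, width l u t k x ^ 2 ≤ (u k (t k) x - l k (t k) x) ^ 2 := fun x =>
      pow_le_pow_left₀ (hp.width_nonneg k x) (width_le k x) 2
    have hi : Integrable (fun x => width l u t k x ^ 2) ν := by
      refine (hint k (t k)).mono' ((measurable_width hl hu k).pow_const 2).aestronglyMeasurable
        (Filter.Eventually.of_forall fun x => ?_)
      rw [Real.norm_of_nonneg (sq_nonneg _)]
      exact hle x
    exact ⟨hi, (integral_mono hi (hint k _) hle).trans (hv k _)⟩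
  have hlinkint : ∀ t ∈ T, ∀ k, Integrable (chainLink l u κ t k) ν := by
    rintro t ⟨f, hf, hp⟩ k
    refine (hw0 (t 0)).integrable.mono' (measurable_chainLink hl hu k).aestronglyMeasurable
      (Filter.Eventually.of_forall fun x => ?_)
    rw [Real.norm_of_nonneg (hp.chainLink_nonneg k x)]
    exact (hp.chainLink_le_width k x).trans (width_le_zero k x)
  have hlink : ∀ k, ∀ t ∈ T, BernsteinAt ν (chainLink l u κ t k) (κ k) (v k) := by
    rintro (_ | k) t ht
    · obtain ⟨f, hf, hp⟩ := id ht
      have hw := hw0 (t 0)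
      have hm := measurable_chainLink (κ := κ) (t := t) hl hu 0
      -- Link `0` lies between `0` and the coarsest width, so monotonicity of `expRem` on `[0, ∞)`
      -- transfers the Bernstein condition from that width.
      have hexp : Integrable
          (fun x => κ 0 ^ 2 * expRem ((u 0 (t 0) x - l 0 (t 0) x) / κ 0)) ν :=
        ((hw.integrable_exp.sub (integrable_const (1 : ℝ))).sub
          (hw.integrable.div_const (κ 0))).const_mul (κ 0 ^ 2)
      refine .of_expRem_le hm (hlinkint t ht 0) hexp (Filter.Eventually.of_forall fun x => ?_) ?_
      · rw [mul_div_cancel_left₀ _ (pow_pos (hκ 0) 2).ne']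
        have h0 := hp.chainLink_nonneg (κ := κ) 0 x
        have h1 := (hp.chainLink_le_width (κ := κ) 0 x).trans (width_le_zero 0 x)
        have h2 := (hκ 0).le
        exact monotoneOn_expRem (Set.mem_Ici.2 (by positivity))
          (Set.mem_Ici.2 (div_nonneg (h0.trans h1) h2)) (by gcongr)
      · rw [integral_const_mul]
        have := hw.integral_le
        rwa [le_div_iff₀ (pow_pos (hκ 0) 2), mul_comm] at this
    · obtain ⟨f, hf, hp⟩ := id ht
      refine .of_abs_le (hκ _) (measurable_chainLink hl hu _) (fun x => ?_) ?_
      · rw [abs_of_nonneg (hp.chainLink_nonneg _ x)]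
        exact hp.chainLink_succ_le (fun k => (hκ k).le) k x
      · refine le_trans (integral_mono_of_nonneg
          (Filter.Eventually.of_forall fun x => sq_nonneg _) (hsqint t ht _).1
          (Filter.Eventually.of_forall fun x => ?_)) (hsqint t ht (k + 1)).2
        exact pow_le_pow_left₀ (hp.chainLink_nonneg _ x) (hp.chainLink_le_width _ x) 2
  have hstep := fun k => hZ.exists_majorant_paths hn T (k + 2)
    (h := fun t => chainLink l u κ t k) (hκ k) (hv0 k) (hH (k + 1)) (hcard (k + 1))
    (fun t t' h => chainLink_congr h) (hlink k)
  choose W hWi hW0 hWle hW using hstep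
  refine ⟨fun ω => W₀ ω + ∑ k ∈ Finset.range (S + 1), (W k ω + v k / κ (k + 1)) + κ (S + 1),
    ?_, ?_, ?_, ?_⟩
  · exact (hW₀i.add (integrable_finsetSum _ fun k _ =>
      (hWi k).add (integrable_const _))).add (integrable_const _)
  · intro ω
    have h1 := hW₀0 ω
    have h2 := (hκ (S + 1)).le
    have h3 : 0 ≤ ∑ k ∈ Finset.range (S + 1), (W k ω + v k / κ (k + 1)) :=
      Finset.sum_nonneg fun k _ => add_nonneg (hW0 k ω) (div_nonneg (hv0 k) (hκ _).le)
    positivity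
  · have hsi : ∀ k, Integrable (fun ω => W k ω + v k / κ (k + 1)) μ := fun k =>
      (hWi k).add (integrable_const _)
    have hsum : Integrable (fun ω => ∑ k ∈ Finset.range (S + 1), (W k ω + v k / κ (k + 1))) μ :=
      integrable_finsetSum _ fun k _ => hsi k
    rw [integral_add (f := fun ω => W₀ ω + ∑ k ∈ Finset.range (S + 1), (W k ω + v k / κ (k + 1)))
      (hW₀i.add hsum) (integrable_const _), integral_add hW₀i hsum,
      integral_finsetSum _ fun k _ => hsi k]
    simp only [integral_const, probReal_univ, one_smul]
    gcongr with k
    rw [integral_add (hWi k) (integrable_const _)]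
    simp only [integral_const, probReal_univ, one_smul]
    gcongr
    exact hWle k
  · intro f hf ω
    choose t htp using fun k => hcov f hf k
    have hp : IsPathOf l u f t := fun k x => htp k x
    have ht : t ∈ T := ⟨f, hf, hp⟩
    have hrest : ∀ k, Integrable (chainRest l u κ t f k) ν := by
      intro k
      refine (hw0 (t 0)).integrable.mono'
        (measurable_chainRest hl hu (hF f hf) k).aestronglyMeasurable
        (Filter.Eventually.of_forall fun x => ?_)
      rw [Real.norm_of_nonneg (hp.chainRest_nonneg k x)]
      exact hp.chainRest_le_zero k x
    have hind : ∀ m, empDev ν Z n (chainRest l u κ t f 0) ω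
        ≤ ∑ k ∈ Finset.range m, (W k ω + v k / κ (k + 1))
          + empDev ν Z n (chainRest l u κ t f m) ω := by
      intro m
      induction m with
      | zero => simp
      | succ m ih =>
        have h1 := empDev_le_add ν Z n (hrest m) ((hlinkint t ht m).add (hrest (m + 1)))
          (fun x => hp.chainRest_le m x) ω
        have h2 := empDev_add ν Z n (hlinkint t ht m) (hrest (m + 1)) ω
        have h3 : ∫ x, ((chainLink l u κ t m + chainRest l u κ t f (m + 1)) x
            - chainRest l u κ t f m x) ∂ν ≤ v m / κ (m + 1) := by
          calc _ ≤ ∫ x, width l u t m x ^ 2 / κ (m + 1) ∂ν :=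
                integral_mono (((hlinkint t ht m).add (hrest (m + 1))).sub (hrest m))
                  ((hsqint t ht m).1.div_const _) (fun x => hp.chain_excess_le hκ m x)
            _ = (∫ x, width l u t m x ^ 2 ∂ν) / κ (m + 1) := integral_div _ _
            _ ≤ _ := div_le_div_of_nonneg_right (hsqint t ht m).2 (hκ _).le
        have h4 := hW m t ht ω
        have h5 : empDev ν Z n (chainLink l u κ t m + chainRest l u κ t f (m + 1)) ω
            = empDev ν Z n (chainLink l u κ t m) ω
              + empDev ν Z n (chainRest l u κ t f (m + 1)) ω := h2
        rw [Finset.sum_range_succ]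
        linarith
    -- The chain is cut at a finite level: the remainder is pointwise at most `κ (S + 1)` and has
    -- nonnegative mean, so no maximal inequality is needed for it.
    have hlast : empDev ν Z n (chainRest l u κ t f (S + 1)) ω ≤ κ (S + 1) := by
      have h1 : 0 ≤ ∫ x, chainRest l u κ t f (S + 1) x ∂ν :=
        integral_nonneg fun x => hp.chainRest_nonneg _ x
      have h2 : (n : ℝ)⁻¹ * ∑ i ∈ Finset.range n, chainRest l u κ t f (S + 1) (Z i ω)
          ≤ (n : ℝ)⁻¹ * ∑ _i ∈ Finset.range n, κ (S + 1) := by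
        gcongr with i
        exact hp.chainRest_succ_le (fun k => (hκ k).le) S _
      have hn0 : (n : ℝ) ≠ 0 := by positivity
      rw [Finset.sum_const, Finset.card_range, nsmul_eq_mul, inv_mul_cancel_left₀ hn0] at h2
      unfold empDev
      linarith
    have hfeq : f = fun x => l 0 (t 0) x + chainRest l u κ t f 0 x := by
      ext x
      rw [chainRest_zero]
      ring
    have h6 : empDev ν Z n f ω
        = empDev ν Z n (l 0 (t 0)) ω + empDev ν Z n (chainRest l u κ t f 0) ω := by
      conv_lhs => rw [hfeq]
      exact empDev_add ν Z n (hl0 (t 0)).integrable (hrest 0) ω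
    have h7 := hW₀ t ht ω
    have h8 := hind (S + 1)
    linarith

end Chaining

/-! ### The maximal inequality under a bracketing entropy condition -/

/-- `[l i, u i]`, `i : ι`, are brackets for the class `F`, with `∫ (u i - l i)² dν ≤ v`. -/
structure IsBracketing {E ι : Type*} [MeasurableSpace E] (ν : Measure E) (F : Set (E → ℝ)) (v : ℝ)
    (l u : ι → E → ℝ) : Prop where
  meas_lower : ∀ i, Measurable (l i)
  meas_upper : ∀ i, Measurable (u i)
  integrable_sq : ∀ i, Integrable (fun x => (u i x - l i x) ^ 2) ν
  integral_sq_le : ∀ i, ∫ x, (u i x - l i x) ^ 2 ∂ν ≤ v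
  cover : ∀ f ∈ F, ∃ i, ∀ x, l i x ≤ f x ∧ f x ≤ u i x

/-- The constant of the geometric series of the entropies. -/
noncomputable def entropyConst (γ : ℝ) : ℝ := (1 - (1 / 2 : ℝ) ^ γ)⁻¹

/-- The constant of the maximal inequality for classes of polynomial bracketing entropy. -/
noncomputable def chainConst (A B γ : ℝ) : ℝ :=
  2 * A * entropyConst γ + B
    + (2 * A * entropyConst γ * 2 ^ γ + B + B * 2 ^ (1 + γ / 2))
      * (1 - (1 / 2 : ℝ) ^ (1 - γ / 2))⁻¹ + 1

lemma half_rpow_lt_one {p : ℝ} (hp : 0 < p) : (1 / 2 : ℝ) ^ p < 1 :=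
  Real.rpow_lt_one (by norm_num) (by norm_num) hp

lemma one_le_entropyConst {γ : ℝ} (hγ : 0 < γ) : 1 ≤ entropyConst γ := by
  have h1 := half_rpow_lt_one hγ
  have h2 : 0 < (1 / 2 : ℝ) ^ γ := Real.rpow_pos_of_pos (by norm_num) _
  exact (one_le_inv₀ (by linarith)).2 (by linarith)

lemma chainConst_pos {A B γ : ℝ} (hA : 0 ≤ A) (hB : 0 ≤ B) (hγ : 0 < γ) (hγ2 : γ < 2) :
    0 < chainConst A B γ := by
  have h1 := one_le_entropyConst hγ
  have h2 := half_rpow_lt_one (p := 1 - γ / 2) (by linarith)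
  have h3 : 0 ≤ (1 - (1 / 2 : ℝ) ^ (1 - γ / 2))⁻¹ := inv_nonneg.2 (by linarith)
  unfold chainConst
  positivity

section

variable {E Ω : Type*} [MeasurableSpace E] [MeasurableSpace Ω]
  {μ : Measure Ω} [IsProbabilityMeasure μ] {ν : Measure E} [IsProbabilityMeasure ν]
  {Z : ℕ → Ω → E}

lemma IsSample.exists_majorant_entropy (hZ : IsSample μ ν Z) {n : ℕ} (hn : 1 ≤ n)
    {F : Set (E → ℝ)} (hF : ∀ f ∈ F, Measurable f) {A B γ R : ℝ} (hB : 0 ≤ B) (hγ : 0 < γ)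
    (hγ2 : γ < 2) (hR : 0 < R) (hRA : R ^ γ ≤ A)
    (hbr : ∀ δ, 0 < δ → δ ≤ R → ∃ (ι : Type) (_ : Fintype ι) (l u : ι → E → ℝ),
      (Fintype.card ι : ℝ) ≤ Real.exp (A * δ ^ (-γ)) ∧ IsBracketing ν F (B * δ ^ 2) l u ∧
      (δ = R → ∀ i, BernsteinAt ν (l i) (R ^ (1 + γ / 2) * √n) (B * δ ^ 2) ∧
        BernsteinAt ν (fun x => u i x - l i x) (R ^ (1 + γ / 2) * √n) (B * δ ^ 2))) :
    ∃ W : Ω → ℝ, Integrable W μ ∧ (∀ ω, 0 ≤ W ω) ∧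
      ∫ ω, W ω ∂μ ≤ chainConst A B γ * (R ^ (1 - γ / 2) / √n) ∧
      ∀ f ∈ F, ∀ ω, empDev ν Z n f ω ≤ W ω := by
  have hn0 : (0 : ℝ) < n := by exact_mod_cast hn
  have hs : 0 < √(n : ℝ) := Real.sqrt_pos.2 hn0
  have hss : √(n : ℝ) * √n = n := Real.mul_self_sqrt hn0.le
  have hA : 0 ≤ A := (Real.rpow_nonneg hR.le _).trans hRA
  set δ : ℕ → ℝ := fun k => R * (1 / 2) ^ k with hδ
  have hδ0 : ∀ k, 0 < δ k := fun k => by positivity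
  have hδR : ∀ k, δ k ≤ R := fun k =>
    mul_le_of_le_one_right hR.le (pow_le_one₀ (by norm_num) (by norm_num))
  have hδs : ∀ k, δ (k + 1) = 1 / 2 * δ k := fun k => by
    simp only [hδ, pow_succ]
    ring
  have hδp : ∀ (k : ℕ) (p : ℝ), δ (k + 1) ^ p = (1 / 2 : ℝ) ^ p * δ k ^ p := fun k p => by
    rw [hδs, Real.mul_rpow (by norm_num) (hδ0 k).le]
  have hhalf : ∀ p : ℝ, (1 / 2 : ℝ) ^ (-p) = 2 ^ p := fun p => by
    rw [one_div, Real.inv_rpow (by norm_num), Real.rpow_neg (by norm_num), inv_inv]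
  -- This truncation level balances the entropy term `κ δ ^ (-γ) / n` against the variance term `δ ^
  -- 2 / κ`. Both become `δ ^ (1 - γ/2) / √n`, which is geometrically summable because `γ < 2`.
  set κ : ℕ → ℝ := fun k => δ k ^ (1 + γ / 2) * √n with hκd
  have hκ : ∀ k, 0 < κ k := fun k => mul_pos (Real.rpow_pos_of_pos (hδ0 k) _) hs
  set c := entropyConst γ with hc
  have hc1 : 1 ≤ c := one_le_entropyConst hγ
  -- The constant `c` sums the entropies of all coarser levels: it is chosen to give `H (k + 1) = H
  -- k + A * δ (k + 1) ^ (-γ)`.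
  set H : ℕ → ℝ := fun k => A * c * δ k ^ (-γ) with hHd
  have hδA : ∀ k, 1 ≤ A * δ k ^ (-γ) := by
    intro k
    -- This is where `R ^ γ ≤ A` enters: entropies of at least `1` allow `1 + H` to be absorbed into
    -- `2 * H`.
    rw [Real.rpow_neg (hδ0 k).le, ← div_eq_mul_inv,
      one_le_div₀ (Real.rpow_pos_of_pos (hδ0 k) _)]
    exact (Real.rpow_le_rpow (hδ0 k).le (hδR k) hγ.le).trans hRA
  have hH1 : ∀ k, 1 ≤ H k := by
    intro k
    have := hδA k
    simp only [hHd]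
    nlinarith
  choose ι hι l u hcard hbrk hbern using fun k => hbr (δ k) (hδ0 k) (hδR k)
  have hδ00 : δ 0 = R := by simp [hδ]
  have hcardH : ∀ k, ∏ j ∈ Finset.range (k + 1), (Fintype.card (ι j) : ℝ) ≤ Real.exp (H k) := by
    intro k
    induction k with
    | zero =>
      simp only [zero_add, Finset.prod_range_one]
      refine (hcard 0).trans (Real.exp_le_exp.2 ?_)
      have := hδA 0
      simp only [hHd]
      nlinarith
    | succ k ih =>
      rw [Finset.prod_range_succ]
      calc _ ≤ Real.exp (H k) * Real.exp (A * δ (k + 1) ^ (-γ)) := by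
            gcongr
            exact hcard _
        _ = Real.exp (H (k + 1)) := by
            rw [← Real.exp_add]
            congr 1
            simp only [hHd, hδp k (-γ)]
            have h1 : c * (1 - (1 / 2 : ℝ) ^ γ) = 1 := by
              rw [hc, entropyConst]
              exact inv_mul_cancel₀ (by linarith [half_rpow_lt_one hγ])
            have h2 : (1 / 2 : ℝ) ^ γ * (1 / 2 : ℝ) ^ (-γ) = 1 := by
              rw [← Real.rpow_add (by norm_num)]
              simp
            linear_combination (-A * δ k ^ (-γ) * (1 / 2 : ℝ) ^ (-γ)) * h1
              - A * δ k ^ (-γ) * c * h2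
  set q : ℝ := (1 / 2 : ℝ) ^ (1 - γ / 2) with hq
  have hq0 : 0 < q := Real.rpow_pos_of_pos (by norm_num) _
  have hq1 : q < 1 := half_rpow_lt_one (by linarith)
  set θ : ℝ := R ^ (1 - γ / 2) / √n with hθ
  have hθ0 : 0 < θ := div_pos (Real.rpow_pos_of_pos hR _) hs
  have hpow : ∀ (k : ℕ) (p : ℝ), δ k ^ p = R ^ p * ((1 / 2 : ℝ) ^ p) ^ k := by
    intro k p
    simp only [hδ]
    rw [Real.mul_rpow hR.le (by positivity), ← Real.rpow_natCast, ← Real.rpow_natCast,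
      ← Real.rpow_mul (by norm_num), ← Real.rpow_mul (by norm_num), mul_comm p]
  have he : ∀ k, δ k ^ (1 - γ / 2) / √n = θ * q ^ k := by
    intro k
    rw [hpow, hθ, hq]
    ring
  have hκH : ∀ k, κ k * δ k ^ (-γ) / n = θ * q ^ k := by
    intro k
    rw [← he, hκd]
    have : δ k ^ (1 - γ / 2) = δ k ^ (1 + γ / 2) * δ k ^ (-γ) := by
      rw [← Real.rpow_add (hδ0 k)]
      congr 1
      ring
    rw [this, div_eq_div_iff hn0.ne' hs.ne']
    linear_combination (δ k ^ (1 + γ / 2) * δ k ^ (-γ)) * hss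
  have hvκ : ∀ k, δ k ^ 2 / κ k = θ * q ^ k := by
    intro k
    rw [← he, hκd]
    have : δ k ^ 2 = δ k ^ (1 - γ / 2) * δ k ^ (1 + γ / 2) := by
      rw [← Real.rpow_add (hδ0 k), ← Real.rpow_natCast]
      congr 1
      push_cast
      ring
    have h2 := Real.rpow_pos_of_pos (hδ0 k) (1 + γ / 2)
    rw [this, div_eq_div_iff (by positivity) hs.ne']
    ring
  have hκs : ∀ k, κ k = 2 ^ (1 + γ / 2) * κ (k + 1) := by
    intro k
    simp only [hκd, hδp, ← hhalf]
    have : (1 / 2 : ℝ) ^ (-(1 + γ / 2)) * (1 / 2 : ℝ) ^ (1 + γ / 2) = 1 := by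
      rw [← Real.rpow_add (by norm_num)]
      simp
    linear_combination (-(δ k ^ (1 + γ / 2) * √n)) * this
  -- The truncation levels tend to `0` for fixed `n`, so the chain can stop once its remainder is
  -- within the target `θ`.
  obtain ⟨S, hS⟩ : ∃ S : ℕ, κ (S + 1) ≤ θ := by
    have hlim : Filter.Tendsto (fun k => κ k) Filter.atTop (nhds 0) := by
      have h1 : ∀ k, κ k = R ^ (1 + γ / 2) * √n * ((1 / 2 : ℝ) ^ (1 + γ / 2)) ^ k := fun k => by
        simp only [hκd, hpow]
        ring
      simp_rw [h1]
      have h2 := tendsto_pow_atTop_nhds_zero_of_lt_one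
        (Real.rpow_nonneg (by norm_num : (0 : ℝ) ≤ 1 / 2) (1 + γ / 2))
        (half_rpow_lt_one (by linarith : 0 < 1 + γ / 2))
      simpa using h2.const_mul (R ^ (1 + γ / 2) * √n)
    have h2 := (hlim.comp (Filter.tendsto_add_atTop_nat 1)).eventually_le_const hθ0
    exact h2.exists
  have hκ0 : κ 0 = R ^ (1 + γ / 2) * √n := by simp only [hκd, hδ00]
  obtain ⟨W, hWi, hW0, hWle, hW⟩ := hZ.exists_majorant_chain hn hF (l := l) (u := u)
    (v := fun k => B * δ k ^ 2) hκ (fun k => (zero_le_one.trans (hH1 k))) hcardH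
    (fun k => (hbrk k).meas_lower) (fun k => (hbrk k).meas_upper)
    (fun k => (hbrk k).integrable_sq) (fun k => (hbrk k).integral_sq_le)
    (fun k => by positivity) (fun i => hκ0 ▸ (hbern 0 hδ00 i).1)
    (fun i => hκ0 ▸ (hbern 0 hδ00 i).2) (fun f hf k => (hbrk k).cover f hf) S
  refine ⟨W, hWi, hW0, hWle.trans ?_, hW⟩
  have hfirst : κ 0 / n * (1 + H 0) + B * δ 0 ^ 2 / κ 0 ≤ (2 * A * c + B) * θ := by
    have h1 : κ 0 / n * (1 + H 0) ≤ κ 0 / n * (2 * H 0) := by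
      have := hκ 0
      gcongr
      linarith [hH1 0]
    have h2 : κ 0 / n * (2 * H 0) = 2 * A * c * (κ 0 * δ 0 ^ (-γ) / n) := by
      simp only [hHd]
      ring
    have h3 : B * δ 0 ^ 2 / κ 0 = B * (δ 0 ^ 2 / κ 0) := by ring
    have h4 := hκH 0
    have h5 := hvκ 0
    rw [pow_zero, mul_one] at h4 h5
    rw [h4] at h2
    rw [h5] at h3
    linarith
  set D : ℝ := 2 * A * c * 2 ^ γ + B + B * 2 ^ (1 + γ / 2) with hD
  have hD0 : 0 ≤ D := by positivity
  have hterm : ∀ k, κ k / n * (1 + H (k + 1)) + B * δ k ^ 2 / κ k + B * δ k ^ 2 / κ (k + 1)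
      ≤ D * (θ * q ^ k) := by
    intro k
    have h1 : κ k / n * (1 + H (k + 1)) ≤ κ k / n * (2 * H (k + 1)) := by
      have := hκ k
      gcongr
      linarith [hH1 (k + 1)]
    have h2 : κ k / n * (2 * H (k + 1)) = 2 * A * c * 2 ^ γ * (κ k * δ k ^ (-γ) / n) := by
      simp only [hHd, hδp, hhalf]
      ring
    have h3 : B * δ k ^ 2 / κ k = B * (δ k ^ 2 / κ k) := by ring
    have h4 : B * δ k ^ 2 / κ (k + 1) = B * 2 ^ (1 + γ / 2) * (δ k ^ 2 / κ k) := by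
      rw [hκs k]
      have := (hκ (k + 1)).ne'
      have h5 : (2 : ℝ) ^ (1 + γ / 2) ≠ 0 := (Real.rpow_pos_of_pos (by norm_num) _).ne'
      field_simp
    rw [hκH] at h2
    rw [hvκ] at h3 h4
    rw [hD]
    linarith
  have hsum : ∑ k ∈ Finset.range (S + 1), (κ k / n * (1 + H (k + 1)) + B * δ k ^ 2 / κ k
      + B * δ k ^ 2 / κ (k + 1)) ≤ D * (1 - q)⁻¹ * θ := by
    calc _ ≤ ∑ k ∈ Finset.range (S + 1), D * (θ * q ^ k) := Finset.sum_le_sum fun k _ => hterm k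
      _ = D * θ * ∑ k ∈ Finset.range (S + 1), q ^ k := by
          rw [Finset.mul_sum]
          exact Finset.sum_congr rfl fun k _ => by ring
      _ ≤ D * θ * (1 - q)⁻¹ := by
          gcongr
          rw [← tsum_geometric_of_lt_one hq0.le hq1]
          exact (summable_geometric_of_lt_one hq0.le hq1).sum_le_tsum _ fun k _ => by positivity
      _ = _ := by ring
  calc _ ≤ (2 * A * c + B) * θ + D * (1 - q)⁻¹ * θ + θ := by linarith
    _ = chainConst A B γ * θ := by
      rw [chainConst]
      ring

end

/-! ### Normalized brackets for the square roots of the midpoints -/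

/-- A finite entropy excludes the infimum over the empty set, and the infimum of a nonempty subset
of `ℕ∞` is attained. -/
lemma bracketing_of_entropy_le {E : Type*} [MeasurableSpace E] {r : ℝ≥0∞} {Q : Measure E} {δ c : ℝ}
    {F : Set (E → ℝ)} (h : bracketingEntropy r Q δ F ≤ (c : EReal)) :
    ∃ N : ℕ, (N : ℝ) ≤ Real.exp c ∧ HasBracketing r Q δ F N := by
  have h1 : ((bracketingNumber r Q δ F : ℕ∞) : ℝ≥0∞) ≤ ENNReal.ofReal (Real.exp c) := by
    rwa [← ENNReal.log_le_log_iff, ← EReal.exp_coe, EReal.log_exp]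
  have hne : {N : ℕ∞ | ∃ m : ℕ, N = (m : ℕ∞) ∧ HasBracketing r Q δ F m}.Nonempty := by
    by_contra hcon
    rw [Set.not_nonempty_iff_eq_empty] at hcon
    rw [bracketingNumber, hcon, sInf_empty] at h1
    simp at h1
  obtain ⟨m, hm, hb⟩ := csInf_mem hne
  refine ⟨m, ?_, hb⟩
  rw [bracketingNumber, hm, ENat.toENNReal_coe] at h1
  rwa [← ENNReal.ofReal_natCast, ENNReal.ofReal_le_ofReal_iff (Real.exp_pos _).le] at h1

lemma integral_sq_le_of_eLpNorm_two_le {E : Type*} [MeasurableSpace E] {Q : Measure E}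
    {f : E → ℝ} {δ : ℝ} (hδ : 0 ≤ δ) (hf : Measurable f)
    (h : eLpNorm f 2 Q ≤ ENNReal.ofReal δ) :
    Integrable (fun x => f x ^ 2) Q ∧ ∫ x, f x ^ 2 ∂Q ≤ δ ^ 2 := by
  have hm : MemLp f 2 Q := ⟨hf.aestronglyMeasurable, h.trans_lt ENNReal.ofReal_lt_top⟩
  refine ⟨hm.integrable_sq, ?_⟩
  rw [hm.eLpNorm_eq_integral_rpow_norm (by norm_num) (by norm_num),
    ENNReal.ofReal_le_ofReal_iff hδ] at h
  have h0 : 0 ≤ ∫ x, f x ^ 2 ∂Q := integral_nonneg fun x => sq_nonneg _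
  have h1 : ∫ x, ‖f x‖ ^ (2 : ℝ≥0∞).toReal ∂Q = ∫ x, f x ^ 2 ∂Q := by simp
  rw [h1, show ((2 : ℝ≥0∞).toReal)⁻¹ = 1 / 2 by norm_num, ← Real.sqrt_eq_rpow] at h
  exact (Real.sqrt_le_left hδ).1 h

/-- Brackets for the functions `((g + g₀) / 2) ^ (1/2)`, `g ∈ G`, of size `δ` in `L₂(Q)`, which
respect the bounds `g₀ / 2` and `K` and each of which is used by some `g ∈ G`. -/
structure IsSqrtMidBracketing {E ι : Type*} [MeasurableSpace E] (Q : Measure E) (g₀ : E → ℝ)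
    (K : ℝ) (G : Set (E → ℝ)) (δ : ℝ) (l u : ι → E → ℝ) : Prop where
  meas_lower : ∀ i, Measurable (l i)
  meas_upper : ∀ i, Measurable (u i)
  sqrt_le_lower : ∀ i x, √(g₀ x / 2) ≤ l i x
  upper_le : ∀ i x, u i x ≤ √K
  integral_sq_le : ∀ i, ∫ x, (u i x - l i x) ^ 2 ∂Q ≤ δ ^ 2
  used : ∀ i, ∃ g ∈ G, ∀ x, l i x ≤ √((g x + g₀ x) / 2) ∧ √((g x + g₀ x) / 2) ≤ u i x
  cover : ∀ g ∈ G, ∃ i, ∀ x, l i x ≤ √((g x + g₀ x) / 2) ∧ √((g x + g₀ x) / 2) ≤ u i x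

/-- The pointwise bounds of `G` apply to the version `g₁ ∈ G`, not to `g₀`. Brackets are clipped to
these bounds, and on the `Q`-null set where `g₁ ≠ g₀` they are replaced by the trivial bracket,
which leaves the `L₂(Q)` size unaffected. -/
lemma HasBracketing.exists_isSqrtMidBracketing {E : Type*} [MeasurableSpace E] {Q : Measure E}
    {g₀ g₁ : E → ℝ} {K δ : ℝ} {G G' : Set (E → ℝ)} {N : ℕ} (hδ : 0 ≤ δ)
    (hG0 : ∀ g ∈ G, ∀ x, 0 ≤ g x) (hGK : ∀ g ∈ G, ∀ x, g x ≤ K) (hg₀ : Measurable g₀)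
    (hg₁m : Measurable g₁) (hg₁ : g₁ ∈ G) (hae : g₁ =ᵐ[Q] g₀) (hG' : G' ⊆ G)
    (h : HasBracketing 2 Q δ (sqrtMidClass G g₀) N) :
    ∃ (ι : Type) (_ : Fintype ι) (l u : ι → E → ℝ), Fintype.card ι ≤ N ∧
      IsSqrtMidBracketing Q g₁ K G' δ l u := by
  classical
  obtain ⟨l, u, hlu, hcov⟩ := h
  let good (g : E → ℝ) (j : Fin N) : Prop :=
    ∀ x, l j x ≤ √((g x + g₀ x) / 2) ∧ √((g x + g₀ x) / 2) ≤ u j x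
  let l' (j : Fin N) (x : E) : ℝ := if g₁ x = g₀ x then max (l j x) √(g₁ x / 2) else √(g₁ x / 2)
  let u' (j : Fin N) (x : E) : ℝ := if g₁ x = g₀ x then min (u j x) √K else √K
  have hbr : ∀ g ∈ G, ∀ j, good g j →
      ∀ x, l' j x ≤ √((g x + g₁ x) / 2) ∧ √((g x + g₁ x) / 2) ≤ u' j x := by
    intro g hg j hgood x
    have h1 : √(g₁ x / 2) ≤ √((g x + g₁ x) / 2) :=
      Real.sqrt_le_sqrt (by linarith [hG0 g hg x])
    have h2 : √((g x + g₁ x) / 2) ≤ √K :=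
      Real.sqrt_le_sqrt (by linarith [hGK g hg x, hGK g₁ hg₁ x])
    by_cases hx : g₁ x = g₀ x
    · have := hgood x
      rw [← hx] at this
      simp only [l', u', if_pos hx]
      exact ⟨max_le this.1 h1, le_min this.2 h2⟩
    · simp only [l', u', if_neg hx]
      exact ⟨h1, h2⟩
  have hset : MeasurableSet {x | g₁ x = g₀ x} := measurableSet_eq_fun hg₁m hg₀
  have hl'm : ∀ j, Measurable (l' j) := fun j =>
    Measurable.ite hset ((hlu j).1.max (hg₁m.div_const 2).sqrt) (hg₁m.div_const 2).sqrt
  have hu'm : ∀ j, Measurable (u' j) := fun j =>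
    Measurable.ite hset ((hlu j).2.1.min measurable_const) measurable_const
  -- Only brackets met by `G'` are kept: each then has its lower end below its upper end and
  -- contains the midpoint root of an actual member of `G'`.
  refine ⟨{j : Fin N // ∃ g ∈ G', good g j}, inferInstance, fun j => l' j, fun j => u' j, ?_, ?_⟩
  · simpa using Fintype.card_subtype_le fun j : Fin N => ∃ g ∈ G', good g j
  refine ⟨fun j => hl'm j, fun j => hu'm j, fun j x => ?_, fun j x => ?_, fun j => ?_, ?_, ?_⟩
  · simp only [l']
    split_ifs
    · exact le_max_right _ _
    · exact le_rfl
  · simp only [u']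
    split_ifs
    · exact min_le_right _ _
    · exact le_rfl
  · obtain ⟨g, hg, hgood⟩ := j.2
    obtain ⟨hi, hle⟩ := integral_sq_le_of_eLpNorm_two_le hδ ((hlu j).2.1.sub (hlu j).1) (hlu j).2.2
    refine (integral_mono_of_nonneg (.of_forall fun x => sq_nonneg _) hi ?_).trans hle
    filter_upwards [hae] with x hx
    have h1 := hbr g (hG' hg) j hgood x
    have h2 : 0 ≤ u' j x - l' j x := sub_nonneg.2 (h1.1.trans h1.2)
    refine pow_le_pow_left₀ h2 ?_ 2
    simp only [l', u', if_pos hx]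
    exact sub_le_sub (min_le_left _ _) (le_max_left _ _)
  · intro j
    obtain ⟨g, hg, hgood⟩ := j.2
    exact ⟨g, hg, hbr g (hG' hg) j hgood⟩
  · intro g hg
    obtain ⟨j, hj⟩ := hcov _ ⟨g, hG' hg, rfl⟩
    exact ⟨⟨j, g, hg, hj⟩, hbr g (hG' hg) j hj⟩

/-! ### Integration against the likelihood ratio -/

section Density

variable {E : Type*} [MeasurableSpace E] {P Q : Measure E} {g₀ : E → ℝ}

lemma integral_density (hg₀ : Measurable g₀) (hg₀0 : ∀ x, 0 ≤ g₀ x)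
    (hPQ : P = Q.withDensity fun x => ENNReal.ofReal (g₀ x)) (φ : E → ℝ) :
    ∫ x, φ x ∂P = ∫ x, g₀ x * φ x ∂Q := by
  rw [hPQ, integral_withDensity_eq_integral_toReal_smul hg₀.ennreal_ofReal
    (.of_forall fun x => ENNReal.ofReal_lt_top)]
  simp [hg₀0]

lemma integrable_density (hg₀ : Measurable g₀) (hg₀0 : ∀ x, 0 ≤ g₀ x)
    (hPQ : P = Q.withDensity fun x => ENNReal.ofReal (g₀ x)) {φ : E → ℝ} :
    Integrable φ P ↔ Integrable (fun x => g₀ x * φ x) Q := by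
  rw [hPQ, integrable_withDensity_iff hg₀.ennreal_ofReal
    (.of_forall fun x => ENNReal.ofReal_lt_top)]
  simp [hg₀0, mul_comm]

lemma integrable_density_of_bound [IsFiniteMeasure Q] (hg₀ : Measurable g₀) (hg₀0 : ∀ x, 0 ≤ g₀ x)
    (hPQ : P = Q.withDensity fun x => ENNReal.ofReal (g₀ x)) {φ : E → ℝ} (hφ : Measurable φ)
    {C : ℝ} (hC : ∀ x, |g₀ x * φ x| ≤ C) : Integrable φ P :=
  (integrable_density hg₀ hg₀0 hPQ).2
    (.of_bound (hg₀.mul hφ).aestronglyMeasurable C (.of_forall hC))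

lemma abs_log_le_add_one {z : ℝ} (hz : 1 / 2 ≤ z) : |Real.log z| ≤ z + 1 := by
  have h0 : 0 < z := by linarith
  have h1 := Real.log_le_sub_one_of_pos h0
  have h2 := Real.one_sub_inv_le_log_of_pos h0
  have h3 : z⁻¹ ≤ 2 := by
    rw [inv_le_comm₀ h0 (by norm_num)]
    linarith
  rw [abs_le]
  constructor <;> linarith

/-- The weight `a` compensates the linear growth in `|log z| ≤ z + 1`, since `a * (b / a + 1) = b +
a ≤ 3 * C`. At `a = 0` the product vanishes. -/
lemma abs_mul_log_div_le {a b C : ℝ} (ha : 0 ≤ a) (hab : a / 2 ≤ b) (hb : b ≤ C) :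
    |a * Real.log (b / a)| ≤ 3 * C := by
  rcases ha.eq_or_lt with h | h
  · rw [← h]
    simp
    linarith
  · rw [abs_mul, abs_of_pos h]
    have h1 : 1 / 2 ≤ b / a := by
      rw [le_div_iff₀ h]
      linarith
    have h2 := mul_le_mul_of_nonneg_left (abs_log_le_add_one h1) h.le
    have h3 : a * (b / a + 1) = b + a := by field_simp
    linarith

end Density

/-! ### Distance to the root of the likelihood ratio inside a bracket -/

section SqrtMid

variable {E : Type*} [MeasurableSpace E] {Q : Measure E} {g₀ : E → ℝ} {K δ : ℝ} {G : Set (E → ℝ)}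
  {ι : Type} {l u : ι → E → ℝ}

/-- The squared `L₂(Q)`-distance between the square roots of `(g + g₀) / 2` and `g₀`. -/
noncomputable def sqrtMidDist (Q : Measure E) (g₀ g : E → ℝ) : ℝ :=
  ∫ x, (√((g x + g₀ x) / 2) - √(g₀ x)) ^ 2 ∂Q

lemma integrable_sq_of_bounds [IsFiniteMeasure Q] {f : E → ℝ} (hf : Measurable f) {a : ℝ}
    (h : ∀ x, |f x| ≤ a) :
    Integrable (fun x => f x ^ 2) Q := by
  refine .of_bound (hf.pow_const 2).aestronglyMeasurable (a ^ 2) (.of_forall fun x => ?_)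
  rw [norm_pow]
  exact pow_le_pow_left₀ (norm_nonneg _) (h x) 2

namespace IsSqrtMidBracketing

lemma lower_le_upper (hb : IsSqrtMidBracketing Q g₀ K G δ l u)
    (i : ι) (x : E) : l i x ≤ u i x := by
  obtain ⟨g, -, hg⟩ := hb.used i
  exact (hg x).1.trans (hg x).2

lemma lower_nonneg (hb : IsSqrtMidBracketing Q g₀ K G δ l u)
    (i : ι) (x : E) : 0 ≤ l i x :=
  (Real.sqrt_nonneg _).trans (hb.sqrt_le_lower i x)

lemma half_le_lower_sq (hb : IsSqrtMidBracketing Q g₀ K G δ l u)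
    (hg₀0 : ∀ x, 0 ≤ g₀ x) (i : ι) (x : E) : g₀ x / 2 ≤ l i x ^ 2 := by
  rw [← Real.sq_sqrt (by linarith [hg₀0 x] : 0 ≤ g₀ x / 2)]
  exact pow_le_pow_left₀ (Real.sqrt_nonneg _) (hb.sqrt_le_lower i x) 2

lemma lower_sq_le_upper_sq (hb : IsSqrtMidBracketing Q g₀ K G δ l u)
    (i : ι) (x : E) : l i x ^ 2 ≤ u i x ^ 2 :=
  pow_le_pow_left₀ (hb.lower_nonneg i x) (hb.lower_le_upper i x) 2

lemma upper_sq_le (hb : IsSqrtMidBracketing Q g₀ K G δ l u)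
    (hK : 0 ≤ K) (i : ι) (x : E) : u i x ^ 2 ≤ K := by
  rw [← Real.sq_sqrt hK]
  exact pow_le_pow_left₀ ((hb.lower_nonneg i x).trans (hb.lower_le_upper i x)) (hb.upper_le i x) 2

variable [IsFiniteMeasure Q]

lemma integrable_sq (hb : IsSqrtMidBracketing Q g₀ K G δ l u)
    (i : ι) : Integrable (fun x => (u i x - l i x) ^ 2) Q := by
  refine integrable_sq_of_bounds ((hb.meas_upper i).sub (hb.meas_lower i)) (a := √K) fun x => ?_
  rw [abs_of_nonneg (sub_nonneg.2 (hb.lower_le_upper i x))]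
  linarith [hb.lower_nonneg i x, hb.upper_le i x]

/-- Functions between the brackets are close to `g₀ ^ (1/2)` in `L₂(Q)`. -/
lemma integral_sub_sqrt_sq_le (hb : IsSqrtMidBracketing Q g₀ K G δ l u)
    (hG : ∀ g ∈ G, Measurable g) (hg₀m : Measurable g₀)
    (hg₀K : ∀ x, g₀ x ≤ K) (hD : ∀ g ∈ G, sqrtMidDist Q g₀ g ≤ δ ^ 2) (i : ι)
    {w : E → ℝ} (hwm : Measurable w) (hw : ∀ x, l i x ≤ w x ∧ w x ≤ u i x) :
    Integrable (fun x => (w x - √(g₀ x)) ^ 2) Q ∧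
      ∫ x, (w x - √(g₀ x)) ^ 2 ∂Q ≤ 4 * δ ^ 2 := by
  obtain ⟨g, hg, hgb⟩ := hb.used i
  have hbound : ∀ v : E → ℝ, (∀ x, l i x ≤ v x ∧ v x ≤ u i x) → ∀ x, |v x - √(g₀ x)| ≤ √K := by
    intro v hv x
    have h1 := Real.sqrt_le_sqrt (hg₀K x)
    rw [abs_le]
    constructor
    · linarith [hb.lower_nonneg i x, (hv x).1]
    · linarith [Real.sqrt_nonneg (g₀ x), (hv x).2, hb.upper_le i x]
  have hi := integrable_sq_of_bounds (Q := Q) (hwm.sub hg₀m.sqrt) (hbound w hw)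
  refine ⟨hi, ?_⟩
  have hi2 : Integrable (fun x => (√((g x + g₀ x) / 2) - √(g₀ x)) ^ 2) Q :=
    integrable_sq_of_bounds ((((hG g hg).add hg₀m).div_const 2).sqrt.sub hg₀m.sqrt)
      (hbound (fun x => √((g x + g₀ x) / 2)) hgb)
  calc ∫ x, (w x - √(g₀ x)) ^ 2 ∂Q
      ≤ ∫ x, (2 * (u i x - l i x) ^ 2 + 2 * (√((g x + g₀ x) / 2) - √(g₀ x)) ^ 2) ∂Q := by
        refine integral_mono hi (((hb.integrable_sq i).const_mul 2).add (hi2.const_mul 2))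
          fun x => ?_
        have h1 : (w x - √((g x + g₀ x) / 2)) ^ 2 ≤ (u i x - l i x) ^ 2 := by
          apply sq_le_sq'
          · linarith [(hw x).1, (hgb x).2]
          · linarith [(hw x).2, (hgb x).1]
        simp only
        nlinarith [sq_nonneg (w x - √((g x + g₀ x) / 2) - (√((g x + g₀ x) / 2) - √(g₀ x)))]
    _ = 2 * ∫ x, (u i x - l i x) ^ 2 ∂Q + 2 * sqrtMidDist Q g₀ g := by
        rw [integral_add ((hb.integrable_sq i).const_mul 2) (hi2.const_mul 2),
          integral_const_mul, integral_const_mul, sqrtMidDist]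
    _ ≤ 4 * δ ^ 2 := by linarith [hb.integral_sq_le i, hD g hg]

end IsSqrtMidBracketing

end SqrtMid

/-! ### The empirical processes of the log-likelihood ratios and of the midpoints -/

section Brackets

variable {E : Type*} [MeasurableSpace E] {P Q : Measure E} {g₀ : E → ℝ} {K δ : ℝ}
  {G : Set (E → ℝ)} {ι : Type} {l u : ι → E → ℝ}

/-- The class of the functions `log ((g + g₀) / (2 g₀))`. -/
noncomputable def logMidClass (G : Set (E → ℝ)) (g₀ : E → ℝ) : Set (E → ℝ) :=
  (fun g : E → ℝ => fun x => Real.log ((g x + g₀ x) / 2 / g₀ x)) '' G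

/-- The class of the functions `(g₀ - (g + g₀) / 2) / K`. -/
noncomputable def diffMidClass (G : Set (E → ℝ)) (g₀ : E → ℝ) (K : ℝ) : Set (E → ℝ) :=
  (fun g : E → ℝ => fun x => (g₀ x - (g x + g₀ x) / 2) / K) '' G

lemma expRem_log_sq_div_le {a b κ : ℝ} (ha : 0 < a) (hb : 0 < b) (hab : a ^ 2 / 2 ≤ b ^ 2)
    (hκ : 1 ≤ κ) :
    expRem (Real.log (b ^ 2 / a ^ 2) / κ) ≤ 8 * (b / a - 1) ^ 2 / κ ^ 2 := by
  have hy : 1 / 2 ≤ (b / a) ^ 2 := by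
    rw [div_pow, le_div_iff₀ (by positivity)]
    linarith
  have h := expRem_mul_two_log_le (a := 1 / κ) (by positivity)
    ((div_le_one₀ (by linarith)).2 hκ) (div_pos hb ha) hy
  rw [← div_pow, Real.log_pow]
  calc _ = expRem (1 / κ * (2 * Real.log (b / a))) := by
        congr 1
        push_cast
        ring
    _ ≤ _ := h
    _ = _ := by
        field_simp

lemma sq_sub_sq_div_sq_le {a b K : ℝ} (hK : 1 ≤ K) (ha0 : 0 ≤ a) (hb0 : 0 ≤ b) (ha : a ≤ √K)
    (hb : b ≤ √K) : ((a ^ 2 - b ^ 2) / K) ^ 2 ≤ 4 * (a - b) ^ 2 := by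
  have hKs : √K * √K = K := Real.mul_self_sqrt (by linarith)
  have h1 : ((a ^ 2 - b ^ 2) / K) ^ 2 = (a - b) ^ 2 * (a + b) ^ 2 / K ^ 2 := by
    rw [div_pow]
    ring
  rw [h1, div_le_iff₀ (by positivity)]
  have h2 : (a + b) ^ 2 ≤ 4 * K := by nlinarith [Real.sqrt_nonneg K]
  have h3 : (a + b) ^ 2 ≤ 4 * K ^ 2 := by nlinarith
  nlinarith [sq_nonneg (a - b)]

lemma abs_sub_div_le_one {a b K : ℝ} (hK : 0 < K) (ha0 : 0 ≤ a) (hb0 : 0 ≤ b) (ha : a ≤ K)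
    (hb : b ≤ K) : |(a - b) / K| ≤ 1 := by
  rw [abs_div, abs_of_pos hK, div_le_one hK, abs_le]
  constructor <;> linarith

/-- The derivative of `2 log` on the bracket is at most `2 / l`, and the weight satisfies `g₀ ≤ 2 *
l ^ 2`. So `L₂(Q)` brackets for the roots become `L₂(P)` brackets for the logarithms. -/
lemma IsSqrtMidBracketing.log_diff_sq_le (hb : IsSqrtMidBracketing Q g₀ K G δ l u)
    (hg₀0 : ∀ x, 0 ≤ g₀ x) (i : ι) (x : E) :
    g₀ x * (Real.log (u i x ^ 2 / g₀ x) - Real.log (l i x ^ 2 / g₀ x)) ^ 2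
      ≤ 8 * (u i x - l i x) ^ 2 := by
  rcases (hg₀0 x).eq_or_lt with h | h
  · rw [← h]
    simp only [zero_mul]
    positivity
  · have hl2 := hb.half_le_lower_sq hg₀0 i x
    have hl : 0 < l i x := by
      refine lt_of_le_of_ne (hb.lower_nonneg i x) fun h0 => ?_
      rw [← h0] at hl2
      norm_num at hl2
      linarith
    have hlu := hb.lower_le_upper i x
    have hu : 0 < u i x := hl.trans_le hlu
    have h1 : Real.log (u i x ^ 2 / g₀ x) - Real.log (l i x ^ 2 / g₀ x)
        = 2 * Real.log (u i x / l i x) := by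
      rw [Real.log_div (by positivity) h.ne', Real.log_div (by positivity) h.ne', Real.log_pow,
        Real.log_pow, Real.log_div hu.ne' hl.ne']
      push_cast
      ring
    have h2 : 0 ≤ Real.log (u i x / l i x) := Real.log_nonneg ((one_le_div hl).2 hlu)
    have h3 : Real.log (u i x / l i x) ≤ (u i x - l i x) / l i x := by
      refine (Real.log_le_sub_one_of_pos (div_pos hu hl)).trans_eq ?_
      field_simp
    have h4 : Real.log (u i x / l i x) ^ 2 ≤ (u i x - l i x) ^ 2 / l i x ^ 2 := by
      rw [← div_pow]
      exact pow_le_pow_left₀ h2 h3 2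
    have h5 : g₀ x * ((u i x - l i x) ^ 2 / l i x ^ 2) ≤ 2 * (u i x - l i x) ^ 2 := by
      rw [mul_div_assoc', div_le_iff₀ (by positivity)]
      nlinarith [sq_nonneg (u i x - l i x)]
    rw [h1]
    nlinarith

variable [IsFiniteMeasure Q]

lemma IsSqrtMidBracketing.isBracketing_log (hb : IsSqrtMidBracketing Q g₀ K G δ l u)
    (hg₀ : Measurable g₀) (hg₀0 : ∀ x, 0 ≤ g₀ x)
    (hPQ : P = Q.withDensity fun x => ENNReal.ofReal (g₀ x)) :
    IsBracketing P (logMidClass G g₀) (32 * δ ^ 2) (fun i x => Real.log (l i x ^ 2 / g₀ x))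
      (fun i x => Real.log (u i x ^ 2 / g₀ x)) := by
  have hlm : ∀ i, Measurable fun x => Real.log (l i x ^ 2 / g₀ x) := fun i =>
    (((hb.meas_lower i).pow_const 2).div hg₀).log
  have hum : ∀ i, Measurable fun x => Real.log (u i x ^ 2 / g₀ x) := fun i =>
    (((hb.meas_upper i).pow_const 2).div hg₀).log
  have hi : ∀ i, Integrable (fun x =>
      g₀ x * (Real.log (u i x ^ 2 / g₀ x) - Real.log (l i x ^ 2 / g₀ x)) ^ 2) Q := by
    intro i
    refine ((hb.integrable_sq i).const_mul 8).mono'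
      (hg₀.mul (((hum i).sub (hlm i)).pow_const 2)).aestronglyMeasurable (.of_forall fun x => ?_)
    rw [Real.norm_of_nonneg (mul_nonneg (hg₀0 x) (sq_nonneg _))]
    exact hb.log_diff_sq_le hg₀0 i x
  refine ⟨hlm, hum, fun i => (integrable_density hg₀ hg₀0 hPQ).2 (hi i), fun i => ?_, ?_⟩
  · rw [integral_density hg₀ hg₀0 hPQ]
    calc _ ≤ ∫ x, 8 * (u i x - l i x) ^ 2 ∂Q :=
          integral_mono (hi i) ((hb.integrable_sq i).const_mul 8)
            (fun x => hb.log_diff_sq_le hg₀0 i x)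
      _ = 8 * ∫ x, (u i x - l i x) ^ 2 ∂Q := integral_const_mul _ _
      _ ≤ 32 * δ ^ 2 := by nlinarith [hb.integral_sq_le i, sq_nonneg δ]
  · rintro _ ⟨g, hg, rfl⟩
    obtain ⟨i, hi⟩ := hb.cover g hg
    refine ⟨i, fun x => ?_⟩
    rcases (hg₀0 x).eq_or_lt with h | h
    -- Where `g₀` vanishes, all three functions are `log (_ / 0) = 0`.
    · simp [← h]
    · have hl2 := hb.half_le_lower_sq hg₀0 i x
      -- A nonpositive midpoint would have root `0` and force `l i x = 0`, against `g₀ / 2 ≤ l ^ 2`.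
      have hs0 : 0 < (g x + g₀ x) / 2 := by
        by_contra hcon
        have := (hi x).1
        rw [Real.sqrt_eq_zero_of_nonpos (not_lt.1 hcon)] at this
        have h0 : l i x = 0 := le_antisymm this (hb.lower_nonneg i x)
        rw [h0] at hl2
        norm_num at hl2
        linarith
      have h1 : l i x ^ 2 ≤ (g x + g₀ x) / 2 := by
        rw [← Real.sq_sqrt hs0.le]
        exact pow_le_pow_left₀ (hb.lower_nonneg i x) (hi x).1 2
      have h2 : (g x + g₀ x) / 2 ≤ u i x ^ 2 := by
        rw [← Real.sq_sqrt hs0.le]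
        exact pow_le_pow_left₀ (Real.sqrt_nonneg _) (hi x).2 2
      have h3 : 0 < l i x ^ 2 := by linarith
      constructor
      · exact Real.log_le_log (by positivity) (by gcongr)
      · exact Real.log_le_log (by positivity) (by gcongr)

/-- Both functions are logarithms of squared ratios that are at least `1/2`. The lower bracket is
compared with `√g₀`, at squared distance at most `4 * δ ^ 2`, which with the factor `8` gives the
constant `32`; the width is compared through `u / l`. -/
lemma IsSqrtMidBracketing.bernsteinAt_log (hb : IsSqrtMidBracketing Q g₀ K G δ l u)
    [IsFiniteMeasure P] (hG : ∀ g ∈ G, Measurable g) (hg₀ : Measurable g₀)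
    (hg₀0 : ∀ x, 0 ≤ g₀ x) (hK : 0 ≤ K) (hg₀K : ∀ x, g₀ x ≤ K)
    (hPQ : P = Q.withDensity fun x => ENNReal.ofReal (g₀ x))
    (hD : ∀ g ∈ G, sqrtMidDist Q g₀ g ≤ δ ^ 2) {κ : ℝ} (hκ : 1 ≤ κ) (i : ι) :
    BernsteinAt P (fun x => Real.log (l i x ^ 2 / g₀ x)) κ (32 * δ ^ 2) ∧
      BernsteinAt P (fun x => Real.log (u i x ^ 2 / g₀ x) - Real.log (l i x ^ 2 / g₀ x)) κ
        (32 * δ ^ 2) := by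
  have hlm : Measurable fun x => Real.log (l i x ^ 2 / g₀ x) :=
    (((hb.meas_lower i).pow_const 2).div hg₀).log
  have hum : Measurable fun x => Real.log (u i x ^ 2 / g₀ x) :=
    (((hb.meas_upper i).pow_const 2).div hg₀).log
  have hli : Integrable (fun x => Real.log (l i x ^ 2 / g₀ x)) P :=
    integrable_density_of_bound hg₀ hg₀0 hPQ hlm fun x =>
      abs_mul_log_div_le (hg₀0 x) (hb.half_le_lower_sq hg₀0 i x)
        ((hb.lower_sq_le_upper_sq i x).trans (hb.upper_sq_le hK i x))
  have hui : Integrable (fun x => Real.log (u i x ^ 2 / g₀ x)) P :=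
    integrable_density_of_bound hg₀ hg₀0 hPQ hum fun x =>
      abs_mul_log_div_le (hg₀0 x)
        ((hb.half_le_lower_sq hg₀0 i x).trans (hb.lower_sq_le_upper_sq i x)) (hb.upper_sq_le hK i x)
  have hlpos : ∀ x, 0 < g₀ x → 0 < l i x := by
    intro x hx
    refine lt_of_le_of_ne (hb.lower_nonneg i x) fun h0 => ?_
    have := hb.half_le_lower_sq hg₀0 i x
    rw [← h0] at this
    norm_num at this
    linarith
  have hzero : expRem 0 = 0 := by simp [expRem]
  constructor
  · obtain ⟨h1, h2⟩ := hb.integral_sub_sqrt_sq_le hG hg₀ hg₀K hD i (hb.meas_lower i)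
      fun x => ⟨le_rfl, hb.lower_le_upper i x⟩
    have hφ : ∀ x, g₀ x * (8 * (l i x / √(g₀ x) - 1) ^ 2) ≤ 8 * (l i x - √(g₀ x)) ^ 2 := by
      intro x
      rcases (hg₀0 x).eq_or_lt with h | h
      · rw [← h]
        simp only [zero_mul]
        positivity
      · have hs := Real.sqrt_pos.2 h
        have : g₀ x = √(g₀ x) ^ 2 := (Real.sq_sqrt h.le).symm
        apply le_of_eq
        nth_rewrite 1 [this]
        field_simp
    have hφm : Measurable fun x => 8 * (l i x / √(g₀ x) - 1) ^ 2 :=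
      ((((hb.meas_lower i).div hg₀.sqrt).sub_const 1).pow_const 2).const_mul 8
    have hφi : Integrable (fun x => g₀ x * (8 * (l i x / √(g₀ x) - 1) ^ 2)) Q := by
      refine (h1.const_mul 8).mono' (hg₀.mul hφm).aestronglyMeasurable (.of_forall fun x => ?_)
      rw [Real.norm_of_nonneg (mul_nonneg (hg₀0 x) (by positivity))]
      exact hφ x
    refine .of_expRem_le hlm hli ((integrable_density hg₀ hg₀0 hPQ).2 hφi)
      (.of_forall fun x => ?_) ?_
    · rcases (hg₀0 x).eq_or_lt with h | h
      · rw [← h]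
        simp only [div_zero, Real.log_zero, zero_div, hzero]
        positivity
      · have h3 := expRem_log_sq_div_le (Real.sqrt_pos.2 h) (hlpos x h)
          (by rw [Real.sq_sqrt h.le]; exact hb.half_le_lower_sq hg₀0 i x) hκ
        rwa [Real.sq_sqrt h.le] at h3
    · rw [integral_density hg₀ hg₀0 hPQ]
      calc _ ≤ ∫ x, 8 * (l i x - √(g₀ x)) ^ 2 ∂Q := integral_mono hφi (h1.const_mul 8) hφ
        _ = 8 * ∫ x, (l i x - √(g₀ x)) ^ 2 ∂Q := integral_const_mul _ _
        _ ≤ 32 * δ ^ 2 := by linarith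
  · have hφ : ∀ x, g₀ x * (8 * (u i x / l i x - 1) ^ 2) ≤ 16 * (u i x - l i x) ^ 2 := by
      intro x
      rcases (hg₀0 x).eq_or_lt with h | h
      · rw [← h]
        simp only [zero_mul]
        positivity
      · have hl := hlpos x h
        have h1 : (u i x / l i x - 1) ^ 2 = (u i x - l i x) ^ 2 / l i x ^ 2 := by
          field_simp
        have h2 := hb.half_le_lower_sq hg₀0 i x
        rw [h1, mul_div_assoc', mul_div_assoc', div_le_iff₀ (by positivity)]
        nlinarith [sq_nonneg (u i x - l i x)]
    have hφm : Measurable fun x => 8 * (u i x / l i x - 1) ^ 2 :=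
      ((((hb.meas_upper i).div (hb.meas_lower i)).sub_const 1).pow_const 2).const_mul 8
    have hφi : Integrable (fun x => g₀ x * (8 * (u i x / l i x - 1) ^ 2)) Q := by
      refine ((hb.integrable_sq i).const_mul 16).mono' (hg₀.mul hφm).aestronglyMeasurable
        (.of_forall fun x => ?_)
      rw [Real.norm_of_nonneg (mul_nonneg (hg₀0 x) (by positivity))]
      exact hφ x
    refine .of_expRem_le (hum.sub hlm) (hui.sub hli) ((integrable_density hg₀ hg₀0 hPQ).2 hφi)
      (.of_forall fun x => ?_) ?_
    · rcases (hg₀0 x).eq_or_lt with h | h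
      · rw [← h]
        simp only [div_zero, Real.log_zero, sub_self, zero_div, hzero]
        positivity
      · have hl := hlpos x h
        have hu := hl.trans_le (hb.lower_le_upper i x)
        have h3 := expRem_log_sq_div_le hl hu
          (by linarith [hb.lower_sq_le_upper_sq i x, sq_nonneg (l i x)]) hκ
        rw [← Real.log_div (by positivity) (by positivity)]
        rwa [div_div_div_cancel_right₀ h.ne']
    · rw [integral_density hg₀ hg₀0 hPQ]
      calc _ ≤ ∫ x, 16 * (u i x - l i x) ^ 2 ∂Q :=
            integral_mono hφi ((hb.integrable_sq i).const_mul 16) hφ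
        _ = 16 * ∫ x, (u i x - l i x) ^ 2 ∂Q := integral_const_mul _ _
        _ ≤ 32 * δ ^ 2 := by nlinarith [hb.integral_sq_le i, sq_nonneg δ]

/-- Subtraction reverses the order, so `u` gives the lower bracket. Division by `K` makes the
functions bounded by `1` and removes `K` from the variance constant. -/
lemma IsSqrtMidBracketing.isBracketing_diff (hb : IsSqrtMidBracketing Q g₀ K G δ l u)
    (hg₀ : Measurable g₀) (hg₀0 : ∀ x, 0 ≤ g₀ x)
    (hG0 : ∀ g ∈ G, ∀ x, 0 ≤ g x) (hK : 1 ≤ K) :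
    IsBracketing Q (diffMidClass G g₀ K) (32 * δ ^ 2) (fun i x => (g₀ x - u i x ^ 2) / K)
      (fun i x => (g₀ x - l i x ^ 2) / K) := by
  have hlm : ∀ i, Measurable fun x => (g₀ x - l i x ^ 2) / K := fun i =>
    (hg₀.sub ((hb.meas_lower i).pow_const 2)).div_const K
  have hum : ∀ i, Measurable fun x => (g₀ x - u i x ^ 2) / K := fun i =>
    (hg₀.sub ((hb.meas_upper i).pow_const 2)).div_const K
  have hle : ∀ i x, ((g₀ x - l i x ^ 2) / K - (g₀ x - u i x ^ 2) / K) ^ 2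
      ≤ 4 * (u i x - l i x) ^ 2 := by
    intro i x
    have h0 := hb.lower_nonneg i x
    have h1 := hb.lower_le_upper i x
    have h2 := hb.upper_le i x
    rw [← sub_div, sub_sub_sub_cancel_left]
    exact sq_sub_sq_div_sq_le hK (h0.trans h1) h0 h2 (h1.trans h2)
  have hi : ∀ i, Integrable (fun x =>
      ((g₀ x - l i x ^ 2) / K - (g₀ x - u i x ^ 2) / K) ^ 2) Q := by
    intro i
    refine ((hb.integrable_sq i).const_mul 4).mono'
      (((hlm i).sub (hum i)).pow_const 2).aestronglyMeasurable (.of_forall fun x => ?_)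
    rw [Real.norm_of_nonneg (sq_nonneg _)]
    exact hle i x
  refine ⟨hum, hlm, hi, fun i => ?_, ?_⟩
  · calc _ ≤ ∫ x, 4 * (u i x - l i x) ^ 2 ∂Q :=
          integral_mono (hi i) ((hb.integrable_sq i).const_mul 4) (hle i)
      _ = 4 * ∫ x, (u i x - l i x) ^ 2 ∂Q := integral_const_mul _ _
      _ ≤ 32 * δ ^ 2 := by nlinarith [hb.integral_sq_le i, sq_nonneg δ]
  · rintro _ ⟨g, hg, rfl⟩
    obtain ⟨i, hi⟩ := hb.cover g hg
    refine ⟨i, fun x => ?_⟩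
    have hs0 : 0 ≤ (g x + g₀ x) / 2 := by linarith [hG0 g hg x, hg₀0 x]
    have h1 : l i x ^ 2 ≤ (g x + g₀ x) / 2 := by
      rw [← Real.sq_sqrt hs0]
      exact pow_le_pow_left₀ (hb.lower_nonneg i x) (hi x).1 2
    have h2 : (g x + g₀ x) / 2 ≤ u i x ^ 2 := by
      rw [← Real.sq_sqrt hs0]
      exact pow_le_pow_left₀ (Real.sqrt_nonneg _) (hi x).2 2
    constructor
    · simp only
      gcongr
    · simp only
      gcongr

lemma IsSqrtMidBracketing.bernsteinAt_diff (hb : IsSqrtMidBracketing Q g₀ K G δ l u)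
    (hG : ∀ g ∈ G, Measurable g) (hg₀ : Measurable g₀)
    (hg₀0 : ∀ x, 0 ≤ g₀ x) (hG0 : ∀ g ∈ G, ∀ x, 0 ≤ g x) (hK : 1 ≤ K) (hg₀K : ∀ x, g₀ x ≤ K)
    (hD : ∀ g ∈ G, sqrtMidDist Q g₀ g ≤ δ ^ 2) {κ : ℝ} (hκ : 1 ≤ κ) (i : ι) :
    BernsteinAt Q (fun x => (g₀ x - u i x ^ 2) / K) κ (32 * δ ^ 2) ∧
      BernsteinAt Q (fun x => (g₀ x - l i x ^ 2) / K - (g₀ x - u i x ^ 2) / K) κ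
        (32 * δ ^ 2) := by
  have hK0 : 0 < K := by linarith
  have hlm : Measurable fun x => (g₀ x - l i x ^ 2) / K :=
    (hg₀.sub ((hb.meas_lower i).pow_const 2)).div_const K
  have hum : Measurable fun x => (g₀ x - u i x ^ 2) / K :=
    (hg₀.sub ((hb.meas_upper i).pow_const 2)).div_const K
  constructor
  · obtain ⟨h1, h2⟩ := hb.integral_sub_sqrt_sq_le hG hg₀ hg₀K hD i (hb.meas_upper i)
      fun x => ⟨hb.lower_le_upper i x, le_rfl⟩
    refine .of_abs_le (by linarith) hum (fun x => ?_) ?_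
    · exact (abs_sub_div_le_one hK0 (hg₀0 x) (sq_nonneg _) (hg₀K x)
        (hb.upper_sq_le hK0.le i x)).trans hκ
    · calc _ ≤ ∫ x, 4 * (u i x - √(g₀ x)) ^ 2 ∂Q := by
            refine integral_mono_of_nonneg (.of_forall fun x => sq_nonneg _) (h1.const_mul 4)
              (.of_forall fun x => ?_)
            have h3 := sq_sub_sq_div_sq_le hK (Real.sqrt_nonneg (g₀ x))
              ((hb.lower_nonneg i x).trans (hb.lower_le_upper i x))
              (Real.sqrt_le_sqrt (hg₀K x)) (hb.upper_le i x)
            rw [Real.sq_sqrt (hg₀0 x)] at h3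
            simp only
            linarith [sub_sq_comm (u i x) √(g₀ x)]
        _ = 4 * ∫ x, (u i x - √(g₀ x)) ^ 2 ∂Q := integral_const_mul _ _
        _ ≤ 32 * δ ^ 2 := by nlinarith [sq_nonneg δ]
  · refine .of_abs_le (by linarith) (hlm.sub hum) (fun x => ?_)
      ((hb.isBracketing_diff hg₀ hg₀0 hG0 hK).integral_sq_le i)
    rw [← sub_div, sub_sub_sub_cancel_left]
    exact (abs_sub_div_le_one hK0 (sq_nonneg _) (sq_nonneg _) (hb.upper_sq_le hK0.le i x)
      ((hb.lower_sq_le_upper_sq i x).trans (hb.upper_sq_le hK0.le i x))).trans hκ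

end Brackets

section Shell

variable {E Ω : Type*} [MeasurableSpace E] [MeasurableSpace Ω]
  {μ : Measure Ω} [IsProbabilityMeasure μ] {P Q : Measure E} [IsProbabilityMeasure P]
  [IsProbabilityMeasure Q] {g₀ : E → ℝ} {K A γ R : ℝ} {G : Set (E → ℝ)} {X Y : ℕ → Ω → E}

/-- The joint maximal inequality for the functions `log ((g + g₀) / (2 g₀))` under `P` and
`g₀ - (g + g₀) / 2` under `Q`, for `g` in a Hellinger ball of radius `R`. -/
lemma exists_majorant_ball (hX : IsSample μ P X) (hY : IsSample μ Q Y) {n : ℕ} (hn : 1 ≤ n)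
    (hG : ∀ g ∈ G, Measurable g) (hG0 : ∀ g ∈ G, ∀ x, 0 ≤ g x)
    (hg₀ : Measurable g₀) (hg₀0 : ∀ x, 0 ≤ g₀ x) (hK : 1 ≤ K) (hg₀K : ∀ x, g₀ x ≤ K)
    (hPQ : P = Q.withDensity fun x => ENNReal.ofReal (g₀ x))
    (hγ : 0 < γ) (hγ2 : γ < 2) (hR : 0 < R) (hRA : R ^ γ ≤ A) (hRn : 1 ≤ R ^ (1 + γ / 2) * √n)
    (hD : ∀ g ∈ G, sqrtMidDist Q g₀ g ≤ R ^ 2)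
    (hbr : ∀ δ, 0 < δ → ∃ (ι : Type) (_ : Fintype ι) (l u : ι → E → ℝ),
      (Fintype.card ι : ℝ) ≤ Real.exp (A * δ ^ (-γ)) ∧ IsSqrtMidBracketing Q g₀ K G δ l u) :
    ∃ W : Ω → ℝ, Integrable W μ ∧ (∀ ω, 0 ≤ W ω) ∧
      ∫ ω, W ω ∂μ ≤ (1 + K) * chainConst A 32 γ * (R ^ (1 - γ / 2) / √n) ∧
      ∀ g ∈ G, ∀ ω, empDev P X n (fun x => Real.log ((g x + g₀ x) / 2 / g₀ x)) ω
        + empDev Q Y n (fun x => g₀ x - (g x + g₀ x) / 2) ω ≤ W ω := by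
  have hK0 : 0 < K := by linarith
  obtain ⟨W₁, h1i, h10, h1le, h1⟩ := hX.exists_majorant_entropy hn (F := logMidClass G g₀)
    (by
      rintro _ ⟨g, hg, rfl⟩
      exact ((((hG g hg).add hg₀).div_const 2).div hg₀).log)
    (B := 32) (by norm_num) hγ hγ2 hR hRA (fun δ hδ _ => by
      obtain ⟨ι, hι, l, u, hcard, hb⟩ := hbr δ hδ
      refine ⟨ι, hι, _, _, hcard, hb.isBracketing_log hg₀ hg₀0 hPQ, ?_⟩
      rintro rfl i
      exact hb.bernsteinAt_log hG hg₀ hg₀0 hK0.le hg₀K hPQ hD hRn i)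
  obtain ⟨W₂, h2i, h20, h2le, h2⟩ := hY.exists_majorant_entropy hn (F := diffMidClass G g₀ K)
    (by
      rintro _ ⟨g, hg, rfl⟩
      exact (hg₀.sub (((hG g hg).add hg₀).div_const 2)).div_const K)
    (B := 32) (by norm_num) hγ hγ2 hR hRA (fun δ hδ _ => by
      obtain ⟨ι, hι, l, u, hcard, hb⟩ := hbr δ hδ
      refine ⟨ι, hι, _, _, hcard, hb.isBracketing_diff hg₀ hg₀0 hG0 hK, ?_⟩
      rintro rfl i
      exact hb.bernsteinAt_diff hG hg₀ hg₀0 hG0 hK hg₀K hD hRn i)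
  -- The factor `K` undoes the normalization in `diffMidClass`.
  refine ⟨fun ω => W₁ ω + K * W₂ ω, h1i.add (h2i.const_mul K), fun ω => ?_, ?_, ?_⟩
  · exact add_nonneg (h10 ω) (mul_nonneg hK0.le (h20 ω))
  · rw [integral_add h1i (h2i.const_mul K), integral_const_mul]
    nlinarith
  · intro g hg ω
    have h3 := h1 _ ⟨g, hg, rfl⟩ ω
    have h4 := h2 _ ⟨g, hg, rfl⟩ ω
    simp only [empDev_div, div_le_iff₀ hK0] at h4
    linarith

end Shell

/-! ### The empirical criterion -/

section Criterion

variable {E : Type*} {n : ℕ} {x y : ℕ → E} {g g' : E → ℝ}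

/-- The empirical criterion of a function which is positive on the first sample. -/
noncomputable def realCriterion (n : ℕ) (x y : ℕ → E) (g : E → ℝ) : ℝ :=
  (n : ℝ)⁻¹ * ∑ i ∈ Finset.range n, Real.log (g (x i))
    - (n : ℝ)⁻¹ * ∑ i ∈ Finset.range n, g (y i)

lemma empCriterion_eq_coe (hg : ∀ i < n, 0 < g (x i)) :
    empCriterion n x y g = (realCriterion n x y g : EReal) := by
  have hsum : ∀ m ≤ n, ∑ i ∈ Finset.range m, ENNReal.log (ENNReal.ofReal (g (x i)))
      = ((∑ i ∈ Finset.range m, Real.log (g (x i)) : ℝ) : EReal) := by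
    intro m hm
    induction m with
    | zero => simp
    | succ m ih =>
      rw [Finset.sum_range_succ, Finset.sum_range_succ, ih (by omega),
        ENNReal.log_ofReal_of_pos (hg m (by omega)), EReal.coe_add]
  rw [empCriterion, hsum n le_rfl, ← EReal.coe_mul, ← EReal.coe_sub, realCriterion]

lemma empCriterion_eq_bot (hg : ∃ i < n, g (x i) ≤ 0) : empCriterion n x y g = ⊥ := by
  obtain ⟨i, hi, hgi⟩ := hg
  have hn : (0 : ℝ) < (n : ℝ)⁻¹ := by
    have : (0 : ℝ) < n := by exact_mod_cast (Nat.zero_le i).trans_lt hi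
    positivity
  rw [empCriterion, ← Finset.add_sum_erase _ _ (Finset.mem_range.2 hi), ENNReal.log_ofReal,
    if_pos hgi, EReal.bot_add, EReal.coe_mul_bot_of_pos hn, EReal.bot_sub]

/-- The convention `log 0 = -∞` works here: a function vanishing at a sample point has criterion `⊥`
and cannot beat a finite value. -/
lemma pos_of_empCriterion_le (hg : ∀ i < n, 0 < g (x i))
    (h : empCriterion n x y g ≤ empCriterion n x y g') : ∀ i < n, 0 < g' (x i) := by
  by_contra! hcon
  rw [empCriterion_eq_bot hcon, empCriterion_eq_coe hg, le_bot_iff] at h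
  exact EReal.coe_ne_bot _ h

end Criterion

/-- With `m` the root of the midpoint, `p = √a` and `q = √b`, one has `(m - p) (m + p) = (q - p) (q
+ p) / 2`, while `m + p ≤ 2 (p + q)`. -/
lemma sub_sqrt_sq_le {a b : ℝ} (ha : 0 ≤ a) (hb : 0 ≤ b) :
    (√a - √b) ^ 2 ≤ 16 * (√((b + a) / 2) - √a) ^ 2 := by
  set p := √a with hp
  set q := √b with hq
  set m := √((b + a) / 2) with hm
  have hp0 : 0 ≤ p := Real.sqrt_nonneg _
  have hq0 : 0 ≤ q := Real.sqrt_nonneg _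
  have hm0 : 0 ≤ m := Real.sqrt_nonneg _
  have hp2 : p ^ 2 = a := Real.sq_sqrt ha
  have hq2 : q ^ 2 = b := Real.sq_sqrt hb
  have hm2 : m ^ 2 = (b + a) / 2 := Real.sq_sqrt (by positivity)
  have hmle : m ≤ p + q := by
    apply le_of_sq_le_sq _ (by positivity)
    nlinarith
  rcases (add_nonneg hp0 hq0).eq_or_lt with h | h
  · have h1 : p = 0 := by linarith
    have h2 : q = 0 := by linarith
    rw [h1, h2, sub_self, zero_pow two_ne_zero]
    positivity
  · have h1 : (m - p) * (m + p) = (q - p) * (q + p) / 2 := by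
      linear_combination hm2 - hp2 / 2 - hq2 / 2
    have h2 : (m + p) ^ 2 ≤ (2 * (p + q)) ^ 2 := pow_le_pow_left₀ (by positivity) (by linarith) 2
    have h3 : (p - q) ^ 2 * (p + q) ^ 2 = 4 * ((m - p) ^ 2 * (m + p) ^ 2) := by
      have : (m - p) ^ 2 * (m + p) ^ 2 = ((m - p) * (m + p)) ^ 2 := by ring
      rw [this, h1]
      ring
    have h4 : (m - p) ^ 2 * (m + p) ^ 2 ≤ (m - p) ^ 2 * (2 * (p + q)) ^ 2 := by gcongr
    have h5 : 0 < (p + q) ^ 2 := by positivity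
    refine le_of_mul_le_mul_right ?_ h5
    rw [h3]
    linarith

lemma abs_sqrt_mid_sub_le {E : Type*} {g g₀ : E → ℝ} {K : ℝ} (hgK : ∀ x, g x ≤ K)
    (hg₀K : ∀ x, g₀ x ≤ K) (x : E) :
    |√((g x + g₀ x) / 2) - √(g₀ x)| ≤ √K := by
  have h1 : √((g x + g₀ x) / 2) ≤ √K := Real.sqrt_le_sqrt (by linarith [hgK x, hg₀K x])
  have h2 : √(g₀ x) ≤ √K := Real.sqrt_le_sqrt (hg₀K x)
  rw [abs_le]
  constructor <;> linarith [Real.sqrt_nonneg ((g x + g₀ x) / 2), Real.sqrt_nonneg (g₀ x)]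

/-! ### Hellinger-type distances, the drift and the basic inequality -/

section Distance

variable {E : Type*} [MeasurableSpace E] {P Q : Measure E} {g g₀ : E → ℝ} {K : ℝ}

lemma sqrtMidDist_nonneg : 0 ≤ sqrtMidDist Q g₀ g := integral_nonneg fun _ => sq_nonneg _

variable [IsProbabilityMeasure Q]

lemma integrable_sqrt_mid_sub_sq (hg : Measurable g) (hg₀ : Measurable g₀)
    (hgK : ∀ x, g x ≤ K) (hg₀K : ∀ x, g₀ x ≤ K) :
    Integrable (fun x => (√((g x + g₀ x) / 2) - √(g₀ x)) ^ 2) Q :=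
  integrable_sq_of_bounds (((hg.add hg₀).div_const 2).sqrt.sub hg₀.sqrt)
    (abs_sqrt_mid_sub_le hgK hg₀K)

lemma sqrtMidDist_le (hg : Measurable g) (hg₀ : Measurable g₀) (hgK : ∀ x, g x ≤ K)
    (hg₀K : ∀ x, g₀ x ≤ K) (hK : 0 ≤ K) : sqrtMidDist Q g₀ g ≤ K := by
  calc sqrtMidDist Q g₀ g ≤ ∫ _x, K ∂Q := by
        refine integral_mono (integrable_sqrt_mid_sub_sq hg hg₀ hgK hg₀K) (integrable_const _)
          fun x => ?_
        have := pow_le_pow_left₀ (abs_nonneg _) (abs_sqrt_mid_sub_le hgK hg₀K x) 2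
        rwa [sq_abs, Real.sq_sqrt hK] at this
    _ = K := by simp

lemma hellinger_le (hg : Measurable g) (hg₀ : Measurable g₀) (hg0 : ∀ x, 0 ≤ g x)
    (hg₀0 : ∀ x, 0 ≤ g₀ x) (hgK : ∀ x, g x ≤ K) (hg₀K : ∀ x, g₀ x ≤ K) :
    hellinger Q g₀ g ≤ 4 * √(sqrtMidDist Q g₀ g) := by
  have h : ∫ x, (√(g₀ x) - √(g x)) ^ 2 ∂Q ≤ 16 * sqrtMidDist Q g₀ g := by
    rw [sqrtMidDist, ← integral_const_mul]
    exact integral_mono_of_nonneg (.of_forall fun x => sq_nonneg _)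
      ((integrable_sqrt_mid_sub_sq hg hg₀ hgK hg₀K).const_mul 16)
      (.of_forall fun x => sub_sqrt_sq_le (hg₀0 x) (hg0 x))
  have h0 := sqrtMidDist_nonneg (Q := Q) (g₀ := g₀) (g := g)
  rw [hellinger]
  apply Real.sqrt_le_iff.2
  refine ⟨by positivity, ?_⟩
  rw [mul_pow, Real.sq_sqrt h0]
  linarith

lemma integrable_log_mid (hg : Measurable g) (hg₀ : Measurable g₀) (hg0 : ∀ x, 0 ≤ g x)
    (hg₀0 : ∀ x, 0 ≤ g₀ x) (hgK : ∀ x, g x ≤ K) (hg₀K : ∀ x, g₀ x ≤ K)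
    (hPQ : P = Q.withDensity fun x => ENNReal.ofReal (g₀ x)) :
    Integrable (fun x => Real.log ((g x + g₀ x) / 2 / g₀ x)) P :=
  integrable_density_of_bound hg₀ hg₀0 hPQ (((hg.add hg₀).div_const 2).div hg₀).log
    fun x => abs_mul_log_div_le (C := K) (hg₀0 x) (by linarith [hg0 x])
      (by linarith [hgK x, hg₀K x])

/-- The drift of the criterion is at least the squared distance. -/
lemma drift_le (hg : Measurable g) (hg₀ : Measurable g₀) (hg0 : ∀ x, 0 ≤ g x)
    (hg₀0 : ∀ x, 0 ≤ g₀ x) (hgK : ∀ x, g x ≤ K) (hg₀K : ∀ x, g₀ x ≤ K)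
    (hPQ : P = Q.withDensity fun x => ENNReal.ofReal (g₀ x)) :
    ∫ x, Real.log ((g x + g₀ x) / 2 / g₀ x) ∂P + ∫ x, (g₀ x - (g x + g₀ x) / 2) ∂Q
      ≤ -sqrtMidDist Q g₀ g := by
  have hi1 := (integrable_density hg₀ hg₀0 hPQ).1
    (integrable_log_mid hg hg₀ hg0 hg₀0 hgK hg₀K hPQ)
  have hi2 : Integrable (fun x => g₀ x - (g x + g₀ x) / 2) Q := by
    refine .of_bound (hg₀.sub ((hg.add hg₀).div_const 2)).aestronglyMeasurable K
      (.of_forall fun x => ?_)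
    rw [Real.norm_eq_abs, abs_le]
    constructor <;> linarith [hg0 x, hg₀0 x, hgK x, hg₀K x]
  rw [integral_density hg₀ hg₀0 hPQ, ← integral_add hi1 hi2, sqrtMidDist, ← integral_neg]
  refine integral_mono (hi1.add hi2) (integrable_sqrt_mid_sub_sq hg hg₀ hgK hg₀K).neg
    fun x => ?_
  have hm0 : 0 ≤ (g x + g₀ x) / 2 := by linarith [hg0 x, hg₀0 x]
  have hms := Real.sq_sqrt hm0
  have hgs := Real.sq_sqrt (hg₀0 x)
  simp only
  rcases (hg₀0 x).eq_or_lt with h | h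
  · rw [← h] at hms ⊢
    simp only [zero_mul, Real.sqrt_zero, sub_zero]
    linarith
  · have hm : 0 < (g x + g₀ x) / 2 := by linarith [hg0 x]
    set m := √((g x + g₀ x) / 2)
    set p := √(g₀ x)
    have hp : 0 < p := Real.sqrt_pos.2 h
    have hmp : 0 < m := Real.sqrt_pos.2 hm
    -- This is `log z ≤ 2 (√z - 1)`; weighted by `g₀ = p ^ 2` and added to `p ^ 2 - m ^ 2`, it
    -- completes the square `-(m - p) ^ 2`.
    have h1 : Real.log ((g x + g₀ x) / 2 / g₀ x) ≤ 2 * (m / p - 1) := by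
      rw [← hms, ← hgs, ← div_pow, Real.log_pow]
      have := Real.log_le_sub_one_of_pos (div_pos hmp hp)
      push_cast
      linarith
    have h2 := mul_le_mul_of_nonneg_left h1 h.le
    have h3 : g₀ x * (2 * (m / p - 1)) = 2 * (p * m - p ^ 2) := by
      rw [← hgs]
      field_simp
    nlinarith

variable {Ω : Type*} {X Y : ℕ → Ω → E}

/-- The basic inequality. -/
lemma realCriterion_sub_le (hg : Measurable g) (hg₀ : Measurable g₀) (hg0 : ∀ x, 0 ≤ g x)
    (hg₀0 : ∀ x, 0 ≤ g₀ x) (hgK : ∀ x, g x ≤ K) (hg₀K : ∀ x, g₀ x ≤ K)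
    (hPQ : P = Q.withDensity fun x => ENNReal.ofReal (g₀ x)) {n : ℕ} {ω : Ω}
    (hgX : ∀ i < n, 0 < g (X i ω)) (hg₀X : ∀ i < n, 0 < g₀ (X i ω)) :
    (realCriterion n (fun i => X i ω) (fun i => Y i ω) g
        - realCriterion n (fun i => X i ω) (fun i => Y i ω) g₀) / 2
      ≤ empDev P X n (fun x => Real.log ((g x + g₀ x) / 2 / g₀ x)) ω
        + empDev Q Y n (fun x => g₀ x - (g x + g₀ x) / 2) ω - sqrtMidDist Q g₀ g := by
  have hdrift := drift_le hg hg₀ hg0 hg₀0 hgK hg₀K hPQ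
  -- Concavity of the logarithm, in the form of the inequality between geometric and arithmetic
  -- means of `g` and `g₀`.
  have h1 : (n : ℝ)⁻¹ * ∑ i ∈ Finset.range n, (Real.log (g (X i ω)) - Real.log (g₀ (X i ω))) / 2
      ≤ (n : ℝ)⁻¹ * ∑ i ∈ Finset.range n,
        Real.log ((g (X i ω) + g₀ (X i ω)) / 2 / g₀ (X i ω)) := by
    gcongr with i hi
    have hi := Finset.mem_range.1 hi
    have ha := hgX i hi
    have hb := hg₀X i hi
    have h2 : Real.log (g (X i ω) * g₀ (X i ω))
        ≤ Real.log (((g (X i ω) + g₀ (X i ω)) / 2) ^ 2) := by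
      refine Real.log_le_log (by positivity) ?_
      nlinarith [sq_nonneg (g (X i ω) - g₀ (X i ω))]
    rw [Real.log_mul ha.ne' hb.ne', Real.log_pow] at h2
    rw [Real.log_div (by positivity) hb.ne']
    push_cast at h2
    linarith
  have h3 : (n : ℝ)⁻¹ * ∑ i ∈ Finset.range n, (g₀ (Y i ω) - (g (Y i ω) + g₀ (Y i ω)) / 2)
      = ((n : ℝ)⁻¹ * ∑ i ∈ Finset.range n, g₀ (Y i ω)
        - (n : ℝ)⁻¹ * ∑ i ∈ Finset.range n, g (Y i ω)) / 2 := by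
    rw [← mul_sub, ← Finset.sum_sub_distrib, mul_div_assoc, Finset.sum_div]
    congr 1
    exact Finset.sum_congr rfl fun i _ => by ring
  rw [← Finset.sum_div, Finset.sum_sub_distrib] at h1
  simp only [empDev, realCriterion]
  rw [h3]
  linarith

end Distance

/-! ### Rates of convergence -/

section Rates

variable {E Ω : Type*} [MeasurableSpace E] [MeasurableSpace Ω]

/-- The joint empirical process of `log ((g + g₀) / (2 g₀))` under `P` and of
`g₀ - (g + g₀) / 2` under `Q`. -/
noncomputable def jointDev (P Q : Measure E) (X Y : ℕ → Ω → E) (g₀ : E → ℝ) (n : ℕ) (g : E → ℝ)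
    (ω : Ω) : ℝ :=
  empDev P X n (fun x => Real.log ((g x + g₀ x) / 2 / g₀ x)) ω
    + empDev Q Y n (fun x => g₀ x - (g x + g₀ x) / 2) ω

/-- Two samples with likelihood ratio `g₀ ∈ G`, where the class `G` is bounded by `K` and has
square root midpoint brackets of polynomial entropy. -/
structure RatioModel (μ : Measure Ω) (P Q : Measure E) (X Y : ℕ → Ω → E) (G : Set (E → ℝ))
    (g₀ : E → ℝ) (K A γ : ℝ) : Prop where
  sample_left : IsSample μ P X
  sample_right : IsSample μ Q Y
  density : P = Q.withDensity fun x => ENNReal.ofReal (g₀ x)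
  mem : g₀ ∈ G
  meas : ∀ g ∈ G, Measurable g
  nonneg : ∀ g ∈ G, ∀ x, 0 ≤ g x
  le_bound : ∀ g ∈ G, ∀ x, g x ≤ K
  one_le_bound : 1 ≤ K
  exponent_pos : 0 < γ
  exponent_lt : γ < 2
  le_entropy : (2 * √K) ^ γ ≤ A
  brackets : ∀ G' ⊆ G, ∀ δ, 0 < δ → ∃ (ι : Type) (_ : Fintype ι) (l u : ι → E → ℝ),
    (Fintype.card ι : ℝ) ≤ Real.exp (A * δ ^ (-γ)) ∧ IsSqrtMidBracketing Q g₀ K G' δ l u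

variable {μ : Measure Ω} {P Q : Measure E} {X Y : ℕ → Ω → E} {G : Set (E → ℝ)} {g₀ : E → ℝ}
  {K A γ R : ℝ} {n : ℕ}

namespace RatioModel

lemma chainConst_nonneg (h : RatioModel μ P Q X Y G g₀ K A γ) :
    0 ≤ (1 + K) * chainConst A 32 γ := by
  have hA : 0 ≤ A := (Real.rpow_nonneg (by positivity) _).trans h.le_entropy
  have := chainConst_pos hA (by norm_num : (0 : ℝ) ≤ 32) h.exponent_pos h.exponent_lt
  have := h.one_le_bound
  positivity

lemma absolutelyContinuous (h : RatioModel μ P Q X Y G g₀ K A γ) : P ≪ Q := by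
  rw [h.density]
  exact withDensity_absolutelyContinuous _ _

lemma ae_pos (h : RatioModel μ P Q X Y G g₀ K A γ) : ∀ᵐ ω ∂μ, ∀ i, 0 < g₀ (X i ω) := by
  have hP : ∀ᵐ x ∂P, 0 < g₀ x := by
    rw [h.density, ae_withDensity_iff (h.meas g₀ h.mem).ennreal_ofReal]
    refine .of_forall fun x hx => ?_
    by_contra hcon
    exact hx (ENNReal.ofReal_eq_zero.2 (not_lt.1 hcon))
  rw [ae_all_iff]
  intro i
  rw [← h.sample_left.law i] at hP
  exact ae_of_ae_map (h.sample_left.meas i).aemeasurable hP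

variable [IsProbabilityMeasure Q]

lemma llr_ae_eq (h : RatioModel μ P Q X Y G g₀ K A γ) :
    llr P Q =ᵐ[P] fun x => Real.log (g₀ x) := by
  have h1 := Measure.rnDeriv_withDensity Q (h.meas g₀ h.mem).ennreal_ofReal
  rw [← h.density] at h1
  filter_upwards [h.absolutelyContinuous h1] with x hx
  rw [llr, hx, ENNReal.toReal_ofReal (h.nonneg g₀ h.mem x)]

/-- Almost surely, the maximizer is positive on the first sample, its criterion is at least that
of the likelihood ratio, and the basic inequality holds. -/
lemma ae_argmax (h : RatioModel μ P Q X Y G g₀ K A γ) {ghat : Ω → E → ℝ}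
    (hghat : ∀ᵐ ω ∂μ, IsArgmax G n (fun i => X i ω) (fun i => Y i ω) (ghat ω)) :
    ∀ᵐ ω ∂μ, ghat ω ∈ G ∧
      klEstimate n (fun i => X i ω) (fun i => Y i ω) (ghat ω)
        = realCriterion n (fun i => X i ω) (fun i => Y i ω) (ghat ω) + 1 ∧
      realCriterion n (fun i => X i ω) (fun i => Y i ω) g₀
        ≤ realCriterion n (fun i => X i ω) (fun i => Y i ω) (ghat ω) ∧
      (realCriterion n (fun i => X i ω) (fun i => Y i ω) (ghat ω)
          - realCriterion n (fun i => X i ω) (fun i => Y i ω) g₀) / 2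
        ≤ jointDev P Q X Y g₀ n (ghat ω) ω - sqrtMidDist Q g₀ (ghat ω) := by
  filter_upwards [hghat, h.ae_pos] with ω hmax hpos
  have hpos' : ∀ i < n, 0 < g₀ (X i ω) := fun i _ => hpos i
  have hle := hmax.2 g₀ h.mem
  have hg := pos_of_empCriterion_le (x := fun i => X i ω) hpos' hle
  rw [empCriterion_eq_coe (x := fun i => X i ω) hpos',
    empCriterion_eq_coe (x := fun i => X i ω) hg, EReal.coe_le_coe_iff] at hle
  refine ⟨hmax.1, ?_, hle, ?_⟩
  · rw [klEstimate, empCriterion_eq_coe (x := fun i => X i ω) hg, EReal.toReal_coe]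
  · exact realCriterion_sub_le (h.meas _ hmax.1) (h.meas g₀ h.mem) (h.nonneg _ hmax.1)
      (h.nonneg g₀ h.mem) (h.le_bound _ hmax.1) (h.le_bound g₀ h.mem) h.density hg hpos'

end RatioModel

variable [IsProbabilityMeasure μ] [IsProbabilityMeasure P] [IsProbabilityMeasure Q]

lemma measure_le_of_integral_le {W : Ω → ℝ} (hW : Integrable W μ) (hW0 : ∀ ω, 0 ≤ W ω)
    {t c : ℝ} (ht : 0 < t) (hc : ∫ ω, W ω ∂μ ≤ c) :
    μ {ω | t ≤ W ω} ≤ ENNReal.ofReal (c / t) := by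
  have h := mul_meas_ge_le_integral_of_nonneg (.of_forall hW0) hW t
  rw [← ofReal_measureReal (measure_ne_top _ _)]
  apply ENNReal.ofReal_le_ofReal
  rw [le_div_iff₀ ht]
  linarith

namespace RatioModel

lemma exists_majorant (h : RatioModel μ P Q X Y G g₀ K A γ) (hn : 1 ≤ n) (hR : 0 < R)
    (hRK : R ≤ 2 * √K) (hRn : 1 ≤ R ^ (1 + γ / 2) * √n) :
    ∃ W : Ω → ℝ, Integrable W μ ∧ (∀ ω, 0 ≤ W ω) ∧
      ∫ ω, W ω ∂μ ≤ (1 + K) * chainConst A 32 γ * (R ^ (1 - γ / 2) / √n) ∧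
      ∀ g ∈ G, sqrtMidDist Q g₀ g ≤ R ^ 2 → ∀ ω, jointDev P Q X Y g₀ n g ω ≤ W ω := by
  have hsub : {g ∈ G | sqrtMidDist Q g₀ g ≤ R ^ 2} ⊆ G := Set.sep_subset _ _
  obtain ⟨W, hWi, hW0, hWle, hW⟩ := exists_majorant_ball h.sample_left h.sample_right hn
    (fun g hg => h.meas g (hsub hg)) (fun g hg => h.nonneg g (hsub hg)) (h.meas g₀ h.mem)
    (h.nonneg g₀ h.mem) h.one_le_bound (h.le_bound g₀ h.mem) h.density h.exponent_pos
    h.exponent_lt hR ((Real.rpow_le_rpow hR.le hRK h.exponent_pos.le).trans h.le_entropy) hRn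
    (fun g hg => hg.2) (h.brackets _ hsub)
  exact ⟨W, hWi, hW0, hWle, fun g hg hgR ω => hW g ⟨hg, hgR⟩ ω⟩

/-- On the event, the majorant of the ball is at least `R ^ 2 / 4`, so Markov's inequality divides
the modulus by the squared radius. -/
lemma measure_shell_le (h : RatioModel μ P Q X Y G g₀ K A γ) (hn : 1 ≤ n) (hR : 0 < R)
    (hRK : R ≤ 2 * √K) (hRn : 1 ≤ R ^ (1 + γ / 2) * √n) :
    μ {ω | ∃ g ∈ G, sqrtMidDist Q g₀ g ≤ R ^ 2 ∧ R ^ 2 / 4 ≤ sqrtMidDist Q g₀ g ∧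
        sqrtMidDist Q g₀ g ≤ jointDev P Q X Y g₀ n g ω}
      ≤ ENNReal.ofReal (4 * ((1 + K) * chainConst A 32 γ) / (R ^ (1 + γ / 2) * √n)) := by
  obtain ⟨W, hWi, hW0, hWle, hW⟩ := h.exists_majorant hn hR hRK hRn
  have hR2 : 0 < R ^ 2 / 4 := by positivity
  refine (measure_mono ?_).trans ((measure_le_of_integral_le hWi hW0 hR2 hWle).trans_eq ?_)
  · rintro ω ⟨g, hg, h1, h2, h3⟩
    exact h2.trans (h3.trans (hW g hg h1 ω))
  · congr 1
    have h1 : R ^ 2 = R ^ (1 - γ / 2) * R ^ (1 + γ / 2) := by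
      rw [← Real.rpow_add hR, ← Real.rpow_natCast]
      congr 1
      push_cast
      ring
    have h2 := Real.rpow_pos_of_pos hR (1 + γ / 2)
    have h3 := Real.rpow_pos_of_pos hR (1 - γ / 2)
    have hs : 0 < √(n : ℝ) := Real.sqrt_pos.2 (by exact_mod_cast hn)
    rw [h1]
    generalize R ^ (1 - γ / 2) = a at *
    generalize R ^ (1 + γ / 2) = b at *
    field_simp

/-- Peeling: `r = n ^ (-1 / (γ + 2))` solves `r ^ (1 + γ/2) √n = 1`, so the shell of radius `2 ^ (j
+ 1) M r` has probability at most `4 C / (2 ^ (j + 1) M)`, and these bounds sum to `4 C / M`. -/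
lemma measure_rate_le (h : RatioModel μ P Q X Y G g₀ K A γ) (hn : 1 ≤ n) {M : ℝ} (hM : 1 ≤ M) :
    μ {ω | ∃ g ∈ G, M * (n : ℝ) ^ (-(1 / (γ + 2))) < √(sqrtMidDist Q g₀ g) ∧
        sqrtMidDist Q g₀ g ≤ jointDev P Q X Y g₀ n g ω}
      ≤ ENNReal.ofReal (4 * ((1 + K) * chainConst A 32 γ) / M) := by
  have hn0 : (0 : ℝ) < n := by exact_mod_cast hn
  have hγ := h.exponent_pos
  set C := (1 + K) * chainConst A 32 γ with hC
  have hC0 : 0 ≤ C := h.chainConst_nonneg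
  set r := (n : ℝ) ^ (-(1 / (γ + 2))) with hr
  have hr0 : 0 < r := Real.rpow_pos_of_pos hn0 _
  have hM0 : 0 < M := by linarith
  have hrn : r ^ (1 + γ / 2) * √n = 1 := by
    rw [hr, ← Real.rpow_mul hn0.le, Real.sqrt_eq_rpow, ← Real.rpow_add hn0]
    convert Real.rpow_zero (n : ℝ) using 2
    field_simp
    ring
  set ρ : ℕ → ℝ := fun j => 2 ^ (j + 1) * M * r with hρ
  have hρ0 : ∀ j, 0 < ρ j := fun j => by positivity
  have hρn : ∀ j, 2 ^ (j + 1) * M ≤ ρ j ^ (1 + γ / 2) * √n := by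
    intro j
    have h1 : (1 : ℝ) ≤ 2 ^ (j + 1) * M :=
      one_le_mul_of_one_le_of_one_le (one_le_pow₀ (by norm_num)) hM
    simp only [hρ]
    rw [Real.mul_rpow (by positivity) hr0.le, mul_assoc, hrn, mul_one]
    exact Real.self_le_rpow_of_one_le h1 (by linarith)
  have hρ1 : ∀ j, 1 ≤ ρ j ^ (1 + γ / 2) * √n := fun j =>
    (one_le_mul_of_one_le_of_one_le (one_le_pow₀ (by norm_num)) hM).trans (hρn j)
  -- The modulus is available only for radii up to `2 √K`. Larger shells are not needed: `√D ≤ √K`,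
  -- and the shell containing `√D` has radius at most `2 √D`.
  let B (j : ℕ) : Set Ω := {ω | ρ j ≤ 2 * √K ∧ ∃ g ∈ G, sqrtMidDist Q g₀ g ≤ ρ j ^ 2 ∧
    ρ j ^ 2 / 4 ≤ sqrtMidDist Q g₀ g ∧ sqrtMidDist Q g₀ g ≤ jointDev P Q X Y g₀ n g ω}
  have hB : ∀ j, μ (B j) ≤ ENNReal.ofReal (4 * C / M * (1 / 2 * (1 / 2) ^ j)) := by
    intro j
    by_cases hj : ρ j ≤ 2 * √K
    · refine (measure_mono fun ω hω => hω.2).trans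
        ((h.measure_shell_le hn (hρ0 j) hj (hρ1 j)).trans (ENNReal.ofReal_le_ofReal ?_))
      calc 4 * C / (ρ j ^ (1 + γ / 2) * √n) ≤ 4 * C / (2 ^ (j + 1) * M) := by
            exact div_le_div_of_nonneg_left (by positivity) (by positivity) (hρn j)
        _ = 4 * C / M * (1 / 2 * (1 / 2) ^ j) := by
            rw [← pow_succ', one_div, inv_pow]
            field_simp
    · have : B j = ∅ := Set.eq_empty_of_forall_notMem fun ω hω => hj hω.1
      rw [this, measure_empty]
      exact zero_le
  have hsub : {ω | ∃ g ∈ G, M * r < √(sqrtMidDist Q g₀ g) ∧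
      sqrtMidDist Q g₀ g ≤ jointDev P Q X Y g₀ n g ω} ⊆ ⋃ j, B j := by
    rintro ω ⟨g, hg, h1, h2⟩
    set d := √(sqrtMidDist Q g₀ g) with hd
    have hd2 : d ^ 2 = sqrtMidDist Q g₀ g := Real.sq_sqrt sqrtMidDist_nonneg
    have hdK : d ≤ √K := Real.sqrt_le_sqrt (sqrtMidDist_le (h.meas g hg) (h.meas g₀ h.mem)
      (h.le_bound g hg) (h.le_bound g₀ h.mem) (by linarith [h.one_le_bound]))
    have hMr : 0 < M * r := by positivity
    obtain ⟨j, hj1, hj2⟩ := exists_nat_pow_near ((one_le_div hMr).2 h1.le) one_lt_two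
    rw [le_div_iff₀ hMr] at hj1
    rw [div_lt_iff₀ hMr] at hj2
    have hρ2 : ρ j = 2 * (2 ^ j * (M * r)) := by
      simp only [hρ]
      ring
    have hρ3 : ρ j = 2 ^ (j + 1) * (M * r) := by
      simp only [hρ]
      ring
    have h0 := hρ0 j
    refine Set.mem_iUnion.2 ⟨j, by linarith, g, hg, ?_, ?_, h2⟩
    · rw [← hd2]
      exact pow_le_pow_left₀ (Real.sqrt_nonneg _) (by linarith) 2
    · rw [← hd2]
      have : (ρ j / 2) ^ 2 ≤ d ^ 2 := pow_le_pow_left₀ (by linarith) (by linarith) 2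
      linarith
  have hs : HasSum (fun j : ℕ => 4 * C / M * (1 / 2 * (1 / 2 : ℝ) ^ j)) (4 * C / M) := by
    have := (hasSum_geometric_two.mul_left (1 / 2)).mul_left (4 * C / M)
    simpa using this
  calc _ ≤ μ (⋃ j, B j) := measure_mono hsub
    _ ≤ ∑' j, μ (B j) := measure_iUnion_le _
    _ ≤ ∑' j : ℕ, ENNReal.ofReal (4 * C / M * (1 / 2 * (1 / 2) ^ j)) := ENNReal.tsum_le_tsum hB
    _ = ENNReal.ofReal (4 * C / M) := by
      rw [← ENNReal.ofReal_tsum_of_nonneg (fun j => by positivity) hs.summable, hs.tsum_eq]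

lemma isBigOInProb_hellinger (h : RatioModel μ P Q X Y G g₀ K A γ) {ghat : ℕ → Ω → E → ℝ}
    (hghat : ∀ n : ℕ, 1 ≤ n →
      ∀ᵐ ω ∂μ, IsArgmax G n (fun i => X i ω) (fun i => Y i ω) (ghat n ω)) :
    IsBigOInProb μ (fun n ω => hellinger Q g₀ (ghat n ω))
      (fun n => (n : ℝ) ^ (-(1 / (γ + 2)))) := by
  intro ε hε
  set C := (1 + K) * chainConst A 32 γ with hC
  have hC0 : 0 ≤ C := h.chainConst_nonneg
  set M := max 1 (4 * C / ε) with hM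
  have hM1 : 1 ≤ M := le_max_left _ _
  refine ⟨4 * M, fun n hn => ?_⟩
  calc _ ≤ μ {ω | ∃ g ∈ G, M * (n : ℝ) ^ (-(1 / (γ + 2))) < √(sqrtMidDist Q g₀ g) ∧
        sqrtMidDist Q g₀ g ≤ jointDev P Q X Y g₀ n g ω} := by
        apply measure_mono_ae
        filter_upwards [h.ae_argmax (hghat n hn)] with ω hω hlt
        obtain ⟨hmem, -, h1, h2⟩ := hω
        have h3 := hellinger_le (Q := Q) (h.meas _ hmem) (h.meas g₀ h.mem) (h.nonneg _ hmem)
          (h.nonneg g₀ h.mem) (h.le_bound _ hmem) (h.le_bound g₀ h.mem)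
        have h4 : 4 * M * (n : ℝ) ^ (-(1 / (γ + 2))) < |hellinger Q g₀ (ghat n ω)| := hlt
        rw [abs_of_nonneg (show 0 ≤ hellinger Q g₀ (ghat n ω) from Real.sqrt_nonneg _)] at h4
        exact ⟨ghat n ω, hmem, by linarith, by linarith⟩
    _ ≤ ENNReal.ofReal (4 * C / M) := h.measure_rate_le hn hM1
    _ ≤ ENNReal.ofReal ε := by
        apply ENNReal.ofReal_le_ofReal
        rw [div_le_iff₀ (by linarith)]
        have := le_max_right 1 (4 * C / ε)
        rw [div_le_iff₀ hε] at this
        linarith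

end RatioModel

/-- The finite maximal inequality is applied to `f` and `-f`, with `H = 1` since `2 ≤ e`; the scale
`L √n` makes both of its terms of order `L / √n`. -/
lemma IsSample.exists_majorant_abs {ν : Measure E} [IsProbabilityMeasure ν] {Z : ℕ → Ω → E}
    (hZ : IsSample μ ν Z) (hn : 1 ≤ n) {f : E → ℝ} (hf : Measurable f) {L : ℝ} (hL : 0 < L)
    (hfL : ∀ x, |f x| ≤ L) :
    ∃ W : Ω → ℝ, Integrable W μ ∧ (∀ ω, 0 ≤ W ω) ∧ ∫ ω, W ω ∂μ ≤ 3 * L / √n ∧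
      ∀ ω, |empDev ν Z n f ω| ≤ W ω := by
  have hn0 : (0 : ℝ) < n := by exact_mod_cast hn
  have hs : 1 ≤ √(n : ℝ) := Real.one_le_sqrt.2 (by exact_mod_cast hn)
  have hs0 : 0 < √(n : ℝ) := by linarith
  have hss : √(n : ℝ) * √n = n := Real.mul_self_sqrt hn0.le
  have hv : ∀ a : ℝ, |a| = 1 → BernsteinAt ν (fun x => a * f x) (L * √n) (L ^ 2) := by
    intro a ha
    refine .of_abs_le (by positivity) (hf.const_mul a) (fun x => ?_) ?_
    · rw [abs_mul, ha, one_mul]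
      exact (hfL x).trans (le_mul_of_one_le_right hL.le hs)
    · have ha2 : a ^ 2 = 1 := by rw [← sq_abs, ha, one_pow]
      calc ∫ x, (a * f x) ^ 2 ∂ν ≤ ∫ _x, L ^ 2 ∂ν := by
            refine integral_mono_of_nonneg (.of_forall fun x => sq_nonneg _) (integrable_const _)
              (.of_forall fun x => ?_)
            simp only [mul_pow, ha2, one_mul]
            rw [← sq_abs]
            exact pow_le_pow_left₀ (abs_nonneg _) (hfL x) 2
        _ = L ^ 2 := by simp
  obtain ⟨W, hWi, hW0, hWle, hW⟩ := hZ.exists_majorant hn (ι := Fin 2)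
    (h := fun i x => (![1, -1] i) * f x) (K := L * √n) (v := L ^ 2) (H := 1) (by positivity)
    (by positivity) zero_le_one
    (by
      have := Real.add_one_le_exp 1
      norm_num at this ⊢
      linarith)
    (fun i => hv _ (by fin_cases i <;> simp))
  refine ⟨W, hWi, hW0, hWle.trans_eq ?_, fun ω => abs_le'.2 ⟨?_, ?_⟩⟩
  · have : (n : ℝ) = √n ^ 2 := by rw [sq, hss]
    rw [this, Real.sqrt_sq hs0.le]
    field_simp
    norm_num
  · simpa using hW 0 ω
  · have h1 := hW 1 ω
    have h2 : empDev ν Z n (fun x => (![1, -1] (1 : Fin 2) : ℝ) * f x) ω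
        = -empDev ν Z n f ω := by
      simp [empDev, integral_neg]
      ring
    linarith

namespace RatioModel

/-- The error splits into the gap of the criterion between `ĝ` and `g₀`, which is nonnegative and at
most twice the joint process, and the error of the estimate at `g₀` itself. The lower bound `K₁`
serves only to make `log g₀` bounded. -/
lemma isBigOInProb_klEstimate (h : RatioModel μ P Q X Y G g₀ K A γ) {ghat : ℕ → Ω → E → ℝ}
    (hghat : ∀ n : ℕ, 1 ≤ n →
      ∀ᵐ ω ∂μ, IsArgmax G n (fun i => X i ω) (fun i => Y i ω) (ghat n ω))
    {K₁ : ℝ} (hK₁ : 0 < K₁) (hg₀K₁ : ∀ x, K₁ ≤ g₀ x) :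
    klDiv P Q ≠ ∞ ∧
      IsBigOInProb μ
        (fun n ω => klEstimate n (fun i => X i ω) (fun i => Y i ω) (ghat n ω) - (klDiv P Q).toReal)
        (fun n => (n : ℝ) ^ (-(1 / 2 : ℝ))) := by
  have hg₀m := h.meas g₀ h.mem
  have hg₀K := h.le_bound g₀ h.mem
  have hK0 : 0 < K := by linarith [h.one_le_bound]
  set L := max |Real.log K₁| |Real.log K| + 1 with hL
  have hL0 : 0 < L := by positivity
  have hlog : ∀ x, |Real.log (g₀ x)| ≤ L := by
    intro x
    have h1 := Real.log_le_log hK₁ (hg₀K₁ x)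
    have h2 := Real.log_le_log (hK₁.trans_le (hg₀K₁ x)) (hg₀K x)
    have h3 := abs_le_max_abs_abs h1 h2
    linarith
  have hlogi : Integrable (fun x => Real.log (g₀ x)) P :=
    .of_bound hg₀m.log.aestronglyMeasurable L (.of_forall hlog)
  have hllr : Integrable (llr P Q) P := hlogi.congr h.llr_ae_eq.symm
  have hkl : (klDiv P Q).toReal = ∫ x, Real.log (g₀ x) ∂P := by
    rw [toReal_klDiv_of_measure_eq h.absolutelyContinuous (by simp), integral_congr_ae h.llr_ae_eq]
  have hint : ∫ x, g₀ x ∂Q = 1 := by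
    have := integral_density hg₀m (h.nonneg g₀ h.mem) h.density fun _ => 1
    simpa using this.symm
  refine ⟨klDiv_ne_top h.absolutelyContinuous hllr, fun ε hε => ?_⟩
  set R := 2 * √K with hR
  have hsK : 1 ≤ √K := Real.one_le_sqrt.2 h.one_le_bound
  have hR1 : 1 ≤ R := by linarith
  set C := 3 * L + 3 * K + 2 * ((1 + K) * chainConst A 32 γ * R ^ (1 - γ / 2)) with hC
  have hC0 : 0 ≤ C := by
    have := h.chainConst_nonneg
    have := Real.rpow_nonneg (by linarith : 0 ≤ R) (1 - γ / 2)
    positivity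
  set M := C / ε + 1 with hM
  have hM0 : 0 < M := by positivity
  refine ⟨M, fun n hn => ?_⟩
  have hn0 : (0 : ℝ) < n := by exact_mod_cast hn
  have hs0 : 0 < √(n : ℝ) := Real.sqrt_pos.2 hn0
  have hs1 : 1 ≤ √(n : ℝ) := Real.one_le_sqrt.2 (by exact_mod_cast hn)
  have hrate : (n : ℝ) ^ (-(1 / 2 : ℝ)) = (√n)⁻¹ := by
    rw [Real.rpow_neg hn0.le, Real.sqrt_eq_rpow]
  obtain ⟨W₁, h1i, h10, h1le, h1⟩ := h.sample_left.exists_majorant_abs hn hg₀m.log hL0 hlog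
  obtain ⟨W₂, h2i, h20, h2le, h2⟩ := h.sample_right.exists_majorant_abs hn hg₀m hK0 fun x => by
    rw [abs_of_nonneg (h.nonneg g₀ h.mem x)]
    exact hg₀K x
  obtain ⟨W₃, h3i, h30, h3le, h3⟩ := h.exists_majorant hn (by linarith) le_rfl
    (one_le_mul_of_one_le_of_one_le
      (Real.one_le_rpow hR1 (by linarith [h.exponent_pos])) hs1)
  have hWi : Integrable (fun ω => W₁ ω + W₂ ω + 2 * W₃ ω) μ :=
    (h1i.add h2i).add (h3i.const_mul 2)
  have hWle : ∫ ω, (W₁ ω + W₂ ω + 2 * W₃ ω) ∂μ ≤ C / √n := by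
    rw [integral_add (f := fun ω => W₁ ω + W₂ ω) (h1i.add h2i) (h3i.const_mul 2),
      integral_add h1i h2i, integral_const_mul]
    calc _ ≤ 3 * L / √n + 3 * K / √n
          + 2 * ((1 + K) * chainConst A 32 γ * (R ^ (1 - γ / 2) / √n)) := by gcongr
      _ = C / √n := by
        rw [hC]
        ring
  calc _ ≤ μ {ω | M / √n ≤ W₁ ω + W₂ ω + 2 * W₃ ω} := by
        apply measure_mono_ae
        filter_upwards [h.ae_argmax (hghat n hn)] with ω hω hlt
        obtain ⟨hmem, heq, hle, hbasic⟩ := hω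
        have hlt' : M * (n : ℝ) ^ (-(1 / 2 : ℝ)) <
            |klEstimate n (fun i => X i ω) (fun i => Y i ω) (ghat n ω) - (klDiv P Q).toReal| := hlt
        rw [hrate, ← div_eq_mul_inv, heq, hkl] at hlt'
        have hD : sqrtMidDist Q g₀ (ghat n ω) ≤ R ^ 2 := by
          have h4 := sqrtMidDist_le (Q := Q) (h.meas _ hmem) hg₀m (h.le_bound _ hmem) hg₀K hK0.le
          rw [hR, mul_pow, Real.sq_sqrt hK0.le]
          linarith
        have h4 := h3 _ hmem hD ω
        have h5 := sqrtMidDist_nonneg (Q := Q) (g₀ := g₀) (g := ghat n ω)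
        -- The `+ 1` in the estimate is exactly the mean `∫ g₀ dQ = 1` that centres the second
        -- sample.
        have h6 : realCriterion n (fun i => X i ω) (fun i => Y i ω) g₀ + 1
            - ∫ x, Real.log (g₀ x) ∂P
            = empDev P X n (fun x => Real.log (g₀ x)) ω - empDev Q Y n g₀ ω := by
          rw [realCriterion, empDev, empDev, hint]
          ring
        have h7 := abs_le.1 (h1 ω)
        have h8 := abs_le.1 (h2 ω)
        have h9 := h30 ω
        refine le_of_lt (lt_of_lt_of_le hlt' ?_)
        rw [abs_le]
        constructor <;> linarith
    _ ≤ ENNReal.ofReal (C / √n / (M / √n)) :=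
        measure_le_of_integral_le hWi
          (fun ω => add_nonneg (add_nonneg (h10 ω) (h20 ω)) (mul_nonneg zero_le_two (h30 ω)))
          (by positivity) hWle
    _ ≤ ENNReal.ofReal ε := by
        apply ENNReal.ofReal_le_ofReal
        rw [div_div_div_cancel_right₀ hs0.ne', div_le_iff₀ hM0, hM, mul_add,
          mul_div_cancel₀ _ hε.ne']
        linarith

end RatioModel

end Rates

/-! ### From the given likelihood ratio to its version in the class -/

lemma hellinger_congr {E : Type*} [MeasurableSpace E] {Q : Measure E} {g₀ g₁ : E → ℝ}
    (h : g₁ =ᵐ[Q] g₀) (g : E → ℝ) : hellinger Q g₁ g = hellinger Q g₀ g := by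
  rw [hellinger, hellinger]
  congr 2
  refine integral_congr_ae ?_
  filter_upwards [h] with x hx
  rw [hx]

/-- A likelihood ratio in a bounded class of polynomial entropy gives a `RatioModel`. -/
lemma RatioModel.of_entropy {E Ω : Type*} [MeasurableSpace E] [MeasurableSpace Ω]
    {P Q : Measure E} {g₀ g₁ : E → ℝ} (hg₀ : Measurable g₀)
    (hPQ : P = Q.withDensity fun x => ENNReal.ofReal (g₀ x)) {μ : Measure Ω} {X Y : ℕ → Ω → E}
    (hX : IsSample μ P X) (hY : IsSample μ Q Y) {G : Set (E → ℝ)}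
    (hG : ∀ g ∈ G, Measurable g) (hG0 : ∀ g ∈ G, ∀ x, 0 ≤ g x) (hg₁ : g₁ ∈ G)
    (hae : g₁ =ᵐ[Q] g₀) {γ A K : ℝ} (hγ : 0 < γ) (hγ2 : γ < 2)
    (hent : ∀ δ : ℝ, 0 < δ →
      bracketingEntropy 2 Q δ (sqrtMidClass G g₀) ≤ ((A * δ ^ (-γ) : ℝ) : EReal))
    (hGK : ∀ g ∈ G, ∀ x, g x ≤ K) :
    RatioModel μ P Q X Y G g₁ (max K 1) (max A ((2 * √(max K 1)) ^ γ)) γ where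
  sample_left := hX
  sample_right := hY
  density := by
    rw [hPQ]
    refine withDensity_congr_ae ?_
    filter_upwards [hae] with x hx
    rw [hx]
  mem := hg₁
  meas := hG
  nonneg := hG0
  le_bound := fun g hg x => (hGK g hg x).trans (le_max_left _ _)
  one_le_bound := le_max_right _ _
  exponent_pos := hγ
  exponent_lt := hγ2
  -- The entropy constant is enlarged so that `R ^ γ` stays below it for every radius `R ≤ 2 √K`
  -- that occurs.
  le_entropy := le_max_right _ _
  brackets := by
    intro G' hG' δ hδ
    obtain ⟨N, hN, hbr⟩ := bracketing_of_entropy_le (hent δ hδ)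
    obtain ⟨ι, hι, l, u, hcard, hb⟩ := hbr.exists_isSqrtMidBracketing hδ.le hG0
      (fun g hg x => (hGK g hg x).trans (le_max_left K 1)) hg₀ (hG g₁ hg₁) hg₁ hae hG'
    refine ⟨ι, hι, l, u, (Nat.cast_le.2 hcard).trans (hN.trans (Real.exp_le_exp.2 ?_)), hb⟩
    exact mul_le_mul_of_nonneg_right (le_max_left _ _) (Real.rpow_nonneg hδ.le _)

end KLEstim

theorem theorem2 {E Ω : Type*} [MeasurableSpace E] [MeasurableSpace Ω]
    -- the two distributions, `P ≪ Q`, and the likelihood ratio `g₀ = dP/dQ`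
    (P Q : Measure E) [IsProbabilityMeasure P] [IsProbabilityMeasure Q]
    (g₀ : E → ℝ) (hg₀_meas : Measurable g₀) (hg₀_nonneg : ∀ x, 0 ≤ g₀ x)
    (hPQ : P = Q.withDensity (fun x => ENNReal.ofReal (g₀ x)))
    -- the two i.i.d. samples
    (μ : Measure Ω) [IsProbabilityMeasure μ]
    (X Y : ℕ → Ω → E)
    (hX_meas : ∀ i, Measurable (X i)) (hX_law : ∀ i, μ.map (X i) = P) (hX_indep : iIndepFun X μ)
    (hY_meas : ∀ i, Measurable (Y i)) (hY_law : ∀ i, μ.map (Y i) = Q) (hY_indep : iIndepFun Y μ)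
    -- the class of functions, which contains the likelihood ratio
    (G : Set (E → ℝ)) (hG_meas : ∀ g ∈ G, Measurable g) (hG_nonneg : ∀ g ∈ G, ∀ x, 0 ≤ g x)
    (hG : ∃ g ∈ G, g =ᵐ[Q] g₀)
    -- the bracketing entropy condition
    (γ : ℝ) (hγ_pos : 0 < γ) (hγ_lt : γ < 2)
    (hent : ∃ A : ℝ, ∀ δ : ℝ, 0 < δ →
      KLEstim.bracketingEntropy 2 Q δ (KLEstim.sqrtMidClass G g₀) ≤ ((A * δ ^ (-γ) : ℝ) : EReal))
    -- the estimator
    (ghat : ℕ → Ω → E → ℝ)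
    (hghat : ∀ n : ℕ, 1 ≤ n →
      ∀ᵐ ω ∂μ, KLEstim.IsArgmax G n (fun i => X i ω) (fun i => Y i ω) (ghat n ω)) :
    ((∃ K₂ : ℝ, ∀ g ∈ G, ∀ x, g x ≤ K₂) →
      KLEstim.IsBigOInProb μ (fun n ω => KLEstim.hellinger Q g₀ (ghat n ω))
        (fun n => (n : ℝ) ^ (-(1 / (γ + 2))))) ∧
    ((∃ K₁ K₂ : ℝ, 0 < K₁ ∧ ∀ g ∈ G, ∀ x, K₁ ≤ g x ∧ g x ≤ K₂) →
      klDiv P Q ≠ ∞ ∧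
      KLEstim.IsBigOInProb μ
        (fun n ω => KLEstim.klEstimate n (fun i => X i ω) (fun i => Y i ω) (ghat n ω)
          - (klDiv P Q).toReal)
        (fun n => (n : ℝ) ^ (-(1 / 2 : ℝ)))) := by
  obtain ⟨A, hA⟩ := hent
  obtain ⟨g₁, hg₁, hae⟩ := hG
  have hmodel := fun (K : ℝ) (hK : ∀ g ∈ G, ∀ x, g x ≤ K) =>
    KLEstim.RatioModel.of_entropy hg₀_meas hPQ ⟨hX_meas, hX_law, hX_indep⟩
      ⟨hY_meas, hY_law, hY_indep⟩ hG_meas hG_nonneg hg₁ hae hγ_pos hγ_lt hA hK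
  refine ⟨?_, ?_⟩
  · rintro ⟨K, hK⟩
    have h := (hmodel K hK).isBigOInProb_hellinger hghat
    simpa only [KLEstim.hellinger_congr hae] using h
  · rintro ⟨K₁, K₂, hK₁, hK⟩
    exact (hmodel K₂ fun g hg x => (hK g hg x).2).isBigOInProb_klEstimate hghat hK₁
      fun x => (hK g₁ hg₁ x).1
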